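/- Let $G$ be a group with a finite generating set $X$, and let $H$ be a finitely generated subgroup of $G$. Then $H$ is strongly quasi-convex (Morse) in $G$ with respect to $X$ if and only if, for every non-principal ultrafilter $\omega$ on $\mathbb{N}=\{1,2,3,\dots\}$, the subspace $\mathrm{Cone}^{\omega}_{G}(H)$ is strongly convex in $\mathrm{Cone}^{\omega}(G)$. Here the notions are as follows. - A path $p\colon[0,\ell]\to S$ in a metric space $S$ (a continuous map, $\ell\ge 0$) is a $(\lambda,C)$-quasi-geodesic if $\frac{|s-t|}{\lambda}-C\le d_S(p(s),p(t))\le\lambda|s-t|+C$ for all $s,t\in[0,\ell]$. The subgroup $H$ is strongly quasi-convex if for all real $\lambda\ge 1$, $C\ge 0$ there is a constant $N$ such that every $(\lambda,C)$-quasi-geodesic in the Cayley graph $\Gamma(G,X)$ (a metric graph with edges of length one) whose endpoints are elements of $H$ is contained in the $N$-neighbourhood of $H$. - $G$ carries the word metric $d_X$ of $X$. $\mathrm{Cone}^{\omega}(G)$ is the asymptotic cone of $(G,d_X)$ with scaling sequence $c_i=i$ and constant observation point the identity $e$: its points are the classes of sequences $(g_i)$ in $G$ with $d_X(e,g_i)/i$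 bounded, with distance $\lim^{\omega} d_X(g_i,h_i)/i$, where sequences at distance $0$ are identified. $\mathrm{Cone}^{\omega}_{G}(H)$ is the set of points that have a representative $(h_i)$ with all $h_i\in H$. - A subset $T$ of a metric space $S$ is strongly convex if every simple (that is, injective) path in $S$ that starts and ends in $T$ is entirely contained in $T$. -/

import Mathlib

open Filter Topology

noncomputable section

/-! ### The word metric -/

/-- The word length of `g` with respect to `X`: the least length of a word in the letters
`X ∪ X⁻¹` that represents `g` (it exists when `X` generates the group). -/
def wordLength {G : Type*} [Group G] (X : Set G) (g : G) : ℕ :=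
  sInf {n | ∃ l : List G, (∀ x ∈ l, x ∈ X ∨ x⁻¹ ∈ X) ∧ l.prod = g ∧ l.length = n}

/-- A finite generating set of the group `G`. -/
structure FiniteGeneratingSet (G : Type*) [Group G] where
  carrier : Set G
  finite : carrier.Finite
  closure_eq_top : Subgroup.closure carrier = ⊤

/-- The group `G` regarded as a metric space, with the word metric of the generating set `X`. -/
@[ext]
structure WordSpace {G : Type*} [Group G] (X : FiniteGeneratingSet G) where
  val : G

section WordMetric

variable {G : Type*} [Group G] {X : Set G}

theorem exists_word (hX : Subgroup.closure X = ⊤) (g : G) :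
    ∃ l : List G, (∀ x ∈ l, x ∈ X ∨ x⁻¹ ∈ X) ∧ l.prod = g ∧ l.length = wordLength X g := by
  obtain ⟨l, hl, hg⟩ : ∃ l : List G, (∀ x ∈ l, x ∈ X ∨ x⁻¹ ∈ X) ∧ l.prod = g := by
    have hg : g ∈ (Subgroup.closure X).toSubmonoid := by rw [hX]; trivial
    rw [Subgroup.closure_toSubmonoid] at hg
    exact Submonoid.exists_list_of_mem_closure hg
  exact Nat.sInf_mem
    (s := {n | ∃ l : List G, (∀ x ∈ l, x ∈ X ∨ x⁻¹ ∈ X) ∧ l.prod = g ∧ l.length = n})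
    ⟨l.length, l, hl, hg, rfl⟩

theorem wordLength_prod_le {l : List G} (hl : ∀ x ∈ l, x ∈ X ∨ x⁻¹ ∈ X) :
    wordLength X l.prod ≤ l.length :=
  Nat.sInf_le ⟨l, hl, rfl, rfl⟩

theorem wordLength_one : wordLength X (1 : G) = 0 :=
  Nat.le_zero.mp (wordLength_prod_le (X := X) (l := []) (by simp))

theorem wordLength_le_one {x : G} (hx : x ∈ X) : wordLength X x ≤ 1 := by
  simpa using wordLength_prod_le (X := X) (l := [x]) (by simp [hx])

theorem eq_one_of_wordLength (hX : Subgroup.closure X = ⊤) {g : G} (h : wordLength X g = 0) :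
    g = 1 := by
  obtain ⟨l, -, hg, hn⟩ := exists_word hX g
  rw [h, List.length_eq_zero_iff] at hn
  simpa [hn] using hg.symm

theorem wordLength_mul_le (hX : Subgroup.closure X = ⊤) (g h : G) :
    wordLength X (g * h) ≤ wordLength X g + wordLength X h := by
  obtain ⟨l, hl, hg, hn⟩ := exists_word hX g
  obtain ⟨m, hm, hh, hk⟩ := exists_word hX h
  rw [← hn, ← hk, ← List.length_append, ← hg, ← hh, ← List.prod_append]
  refine wordLength_prod_le fun x hx => ?_
  rcases List.mem_append.mp hx with hx | hx
  · exact hl x hx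
  · exact hm x hx

theorem wordLength_inv_le (hX : Subgroup.closure X = ⊤) (g : G) :
    wordLength X g⁻¹ ≤ wordLength X g := by
  obtain ⟨l, hl, hg, hn⟩ := exists_word hX g
  have h := wordLength_prod_le (X := X) (l := (l.map fun x => x⁻¹).reverse) (by
    intro x hx
    simp only [List.mem_reverse, List.mem_map] at hx
    obtain ⟨y, hy, rfl⟩ := hx
    rw [inv_inv]
    exact (hl y hy).symm)
  rw [← List.prod_inv_reverse, hg] at h
  simpa [hn] using h

end WordMetric

/-- The word metric `d(g, h) = |g⁻¹ h|_X`. -/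
instance {G : Type*} [Group G] (X : FiniteGeneratingSet G) :
    MetricSpace (WordSpace X) where
  dist g h := (wordLength X.carrier (g.val⁻¹ * h.val) : ℝ)
  dist_self g := by simp [wordLength_one]
  dist_comm g h := by
    have key : ∀ a b : G, wordLength X.carrier (a⁻¹ * b) ≤ wordLength X.carrier (b⁻¹ * a) :=
      fun a b => by
      simpa using wordLength_inv_le X.closure_eq_top (b⁻¹ * a)
    exact congrArg Nat.cast (le_antisymm (key _ _) (key _ _))
  dist_triangle g h k := by
    have key := wordLength_mul_le X.closure_eq_top (g.val⁻¹ * h.val) (h.val⁻¹ * k.val)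
    rw [mul_assoc, mul_inv_cancel_left] at key
    exact_mod_cast key
  eq_of_dist_eq_zero {g h} hd :=
    WordSpace.ext (inv_mul_eq_one.mp (eq_one_of_wordLength X.closure_eq_top (Nat.cast_eq_zero.mp hd)))

/-! ### The Cayley graph as a metric graph -/

/-- Names for the points of the Cayley graph: it has a vertex for every `g`, and for every `g` and
every `x ∈ X` an edge of length one from `g` to `g * x`; `edge g x t` is the point of that edge at
distance `t` (along the edge) from its initial vertex `g`. A point may have several names:
`edge g x 0` and `vertex g` name the same point, and so do `edge g x 1` and `vertex (g * x)`. -/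
inductive CayleyPoint {G : Type*} [Group G] (X : FiniteGeneratingSet G)
  | vertex (g : G) : CayleyPoint X
  | edge (g : G) (x : X.carrier) (t : unitInterval) : CayleyPoint X

namespace CayleyPoint

variable {G : Type*} [Group G] {X : FiniteGeneratingSet G}

/-- The distance, in the Cayley graph, from the point `p` to the vertex `w`. -/
def distToVertex : CayleyPoint X → WordSpace X → ℝ
  | vertex g, w => dist (WordSpace.mk (X := X) g) w
  | edge g x t, w => min ((t : ℝ) + dist (WordSpace.mk (X := X) g) w)
      (1 - (t : ℝ) + dist (WordSpace.mk (X := X) (g * (x : G))) w)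

/-- The infimum of the lengths of the paths from `p` to `q` that pass through some vertex. -/
def distThroughVertex (p q : CayleyPoint X) : ℝ :=
  ⨅ w : WordSpace X, (p.distToVertex w + q.distToVertex w)

open Classical in
/-- The path distance in the Cayley graph: two points of the same edge may also be joined along
that edge; all other paths pass through a vertex. -/
def pathDist : CayleyPoint X → CayleyPoint X → ℝ
  | edge g x s, edge g' x' t =>
      if g = g' ∧ x = x' then
        min |(s : ℝ) - (t : ℝ)| (distThroughVertex (edge g x s) (edge g' x' t))
      else distThroughVertex (edge g x s) (edge g' x' t)
  | p, q => distThroughVertex p q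

theorem distToVertex_nonneg (p : CayleyPoint X) (w : WordSpace X) :
    0 ≤ p.distToVertex w := by
  cases p with
  | vertex g => exact dist_nonneg
  | edge g x t =>
    exact le_min (add_nonneg t.2.1 dist_nonneg) (add_nonneg (by linarith [t.2.2]) dist_nonneg)

theorem distToVertex_le (p : CayleyPoint X) (v w : WordSpace X) :
    p.distToVertex v ≤ p.distToVertex w + dist w v := by
  cases p with
  | vertex g => exact dist_triangle _ _ _
  | edge g x t =>
    simp only [distToVertex]
    have h1 := dist_triangle (WordSpace.mk (X := X) g) w v
    have h2 := dist_triangle (WordSpace.mk (X := X) (g * (x : G))) w v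
    rw [← min_add_add_right]
    exact min_le_min (by linarith) (by linarith)

theorem dist_le_distToVertex (p : CayleyPoint X) (v w : WordSpace X) :
    dist v w ≤ p.distToVertex v + p.distToVertex w := by
  cases p with
  | vertex g => exact dist_triangle_left _ _ _
  | edge g x t =>
    have hx : dist (WordSpace.mk (X := X) g) (WordSpace.mk (X := X) (g * (x : G))) ≤ 1 := by
      change (wordLength X.carrier (g⁻¹ * (g * (x : G))) : ℝ) ≤ 1
      rw [inv_mul_cancel_left]
      exact_mod_cast wordLength_le_one x.2
    have ht := t.2.1
    have ht' := t.2.2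
    have a1 := dist_triangle_left v w (WordSpace.mk (X := X) g)
    have a2 := dist_triangle_left v w (WordSpace.mk (X := X) (g * (x : G)))
    have a3 := dist_triangle4 v (WordSpace.mk (X := X) g) (WordSpace.mk (X := X) (g * (x : G))) w
    have a4 := dist_triangle4 v (WordSpace.mk (X := X) (g * (x : G))) (WordSpace.mk (X := X) g) w
    rw [dist_comm v (WordSpace.mk (X := X) g)] at a3
    rw [dist_comm v (WordSpace.mk (X := X) (g * (x : G))),
      dist_comm (WordSpace.mk (X := X) (g * (x : G))) (WordSpace.mk (X := X) g)]
      at a4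
    simp only [distToVertex]
    rcases min_choice ((t : ℝ) + dist (WordSpace.mk (X := X) g) v)
      (1 - (t : ℝ) + dist (WordSpace.mk (X := X) (g * (x : G))) v) with h | h <;>
    rcases min_choice ((t : ℝ) + dist (WordSpace.mk (X := X) g) w)
      (1 - (t : ℝ) + dist (WordSpace.mk (X := X) (g * (x : G))) w) with h' | h' <;>
    rw [h, h'] <;> linarith

theorem distThroughVertex_le (p q : CayleyPoint X) (w : WordSpace X) :
    p.distThroughVertex q ≤ p.distToVertex w + q.distToVertex w :=
  ciInf_le ⟨0, by
    rintro _ ⟨v, rfl⟩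
    exact add_nonneg (p.distToVertex_nonneg v) (q.distToVertex_nonneg v)⟩ w

theorem le_distThroughVertex {p q : CayleyPoint X} {r : ℝ}
    (h : ∀ w, r ≤ p.distToVertex w + q.distToVertex w) : r ≤ p.distThroughVertex q :=
  haveI : Nonempty (WordSpace X) := ⟨⟨1⟩⟩
  le_ciInf h

theorem distThroughVertex_comm (p q : CayleyPoint X) :
    p.distThroughVertex q = q.distThroughVertex p := by
  simp only [distThroughVertex, add_comm]

theorem distThroughVertex_triangle (p q r : CayleyPoint X) :
    p.distThroughVertex r ≤ p.distThroughVertex q + q.distThroughVertex r := by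
  rw [← sub_le_iff_le_add]
  refine le_distThroughVertex fun v => ?_
  rw [sub_le_comm]
  refine le_distThroughVertex fun w => ?_
  linarith [p.distThroughVertex_le r w, p.distToVertex_le w v, q.dist_le_distToVertex v w]

theorem pathDist_le (p q : CayleyPoint X) : p.pathDist q ≤ p.distThroughVertex q := by
  rcases p with g | ⟨g, x, s⟩ <;> rcases q with h | ⟨h, y, t⟩ <;> simp only [pathDist, le_refl]
  split_ifs
  · exact min_le_right _ _
  · exact le_rfl

theorem pathDist_cases (p q : CayleyPoint X) :
    p.pathDist q = p.distThroughVertex q ∨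
      ∃ g x s t, p = edge g x s ∧ q = edge g x t ∧ p.pathDist q = |(s : ℝ) - (t : ℝ)| := by
  rcases p with g | ⟨g, x, s⟩ <;> rcases q with h | ⟨h, y, t⟩ <;> try exact Or.inl rfl
  by_cases e : g = h ∧ x = y
  · obtain ⟨rfl, rfl⟩ := e
    simp only [pathDist, and_self, if_true]
    rcases min_choice |(s : ℝ) - (t : ℝ)|
      (distThroughVertex (X := X) (edge g x s) (edge g x t)) with e | e
    · exact Or.inr ⟨g, x, s, t, rfl, rfl, e⟩
    · exact Or.inl e
  · exact Or.inl (if_neg e)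

theorem pathDist_edge_le (g : G) (x : X.carrier) (s t : unitInterval) :
    pathDist (X := X) (edge g x s) (edge g x t) ≤ |(s : ℝ) - (t : ℝ)| := by
  simp only [pathDist, and_self, if_true]
  exact min_le_left _ _

theorem distToVertex_edge_le (g : G) (x : X.carrier) (s t : unitInterval) (w : WordSpace X) :
    (edge g x s).distToVertex w ≤ |(s : ℝ) - (t : ℝ)| + (edge g x t).distToVertex w := by
  simp only [distToVertex]
  rw [← min_add_add_left]
  have h1 := le_abs_self ((s : ℝ) - (t : ℝ))
  have h2 := neg_abs_le ((s : ℝ) - (t : ℝ))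
  exact min_le_min (by linarith) (by linarith)

theorem distThroughVertex_edge_le (g : G) (x : X.carrier) (s t : unitInterval) (q : CayleyPoint X) :
    (edge g x s).distThroughVertex q ≤
      |(s : ℝ) - (t : ℝ)| + (edge g x t).distThroughVertex q := by
  rw [← sub_le_iff_le_add']
  refine le_distThroughVertex fun w => ?_
  linarith [distThroughVertex_le (edge g x s) q w, distToVertex_edge_le (X := X) g x s t w]

theorem pathDist_self (p : CayleyPoint X) : p.pathDist p = 0 := by
  cases p with
  | vertex g =>
    refine le_antisymm ?_ (le_distThroughVertex fun w => ?_)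
    · refine (distThroughVertex_le _ _ (WordSpace.mk (X := X) g)).trans ?_
      simp [distToVertex]
    · exact add_nonneg (distToVertex_nonneg _ _) (distToVertex_nonneg _ _)
  | edge g x t =>
    have h : 0 ≤ distThroughVertex (X := X) (edge g x t) (edge g x t) :=
      le_distThroughVertex fun w =>
        add_nonneg (distToVertex_nonneg _ _) (distToVertex_nonneg _ _)
    simpa [pathDist] using h

theorem pathDist_comm (p q : CayleyPoint X) : p.pathDist q = q.pathDist p := by
  rcases p with g | ⟨g, x, s⟩ <;> rcases q with h | ⟨h, y, t⟩ <;> simp only [pathDist] <;>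
    try exact distThroughVertex_comm _ _
  by_cases e : g = h ∧ x = y
  · obtain ⟨rfl, rfl⟩ := e
    simp only [and_self, if_true]
    rw [distThroughVertex_comm, abs_sub_comm]
  · rw [if_neg e, if_neg fun e' => e ⟨e'.1.symm, e'.2.symm⟩]
    exact distThroughVertex_comm _ _

theorem pathDist_triangle (p q r : CayleyPoint X) :
    p.pathDist r ≤ p.pathDist q + q.pathDist r := by
  rcases pathDist_cases p q with h1 | ⟨g, x, s, t, rfl, rfl, h1⟩
  · rcases pathDist_cases q r with h2 | ⟨g, x, s, t, rfl, rfl, h2⟩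
    · rw [h1, h2]
      exact (pathDist_le p r).trans (distThroughVertex_triangle p q r)
    · rw [h1, h2, distThroughVertex_comm, abs_sub_comm, add_comm]
      refine (pathDist_le _ _).trans ?_
      rw [distThroughVertex_comm]
      exact distThroughVertex_edge_le g x t s p
  · rcases pathDist_cases (edge g x t) r with h2 | ⟨g', x', t', u, e, rfl, h2⟩
    · rw [h1, h2]
      exact (pathDist_le _ _).trans (distThroughVertex_edge_le g x s t r)
    · obtain ⟨rfl, rfl, rfl⟩ := edge.inj e
      rw [h1, h2]
      exact (pathDist_edge_le g x s u).trans (abs_sub_le _ _ _)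

end CayleyPoint

instance {G : Type*} [Group G] (X : FiniteGeneratingSet G) :
    PseudoMetricSpace (CayleyPoint X) where
  dist := CayleyPoint.pathDist
  dist_self := CayleyPoint.pathDist_self
  dist_comm := CayleyPoint.pathDist_comm
  dist_triangle := CayleyPoint.pathDist_triangle

/-- The Cayley graph `Γ(G, X)` as a metric graph with edges of length one; names at distance zero
are identified. Its metric is the quotient of `CayleyPoint.pathDist`. -/
abbrev CayleyGraph {G : Type*} [Group G] (X : FiniteGeneratingSet G) : Type _ :=
  SeparationQuotient (CayleyPoint X)

/-- The vertex `g` of the Cayley graph. -/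
def CayleyGraph.vertex {G : Type*} [Group G] (X : FiniteGeneratingSet G) (g : G) :
    CayleyGraph X :=
  SeparationQuotient.mk (CayleyPoint.vertex g)

/-! ### Quasi-geodesics and strong quasi-convexity -/

/-- `p`, restricted to `[0, ℓ]`, is a `(lam, C)`-quasi-geodesic: a path that is a
`(lam, C)`-quasi-isometric embedding. -/
structure IsQuasiGeodesic {S : Type*} [PseudoMetricSpace S] (lam C ℓ : ℝ) (p : ℝ → S) : Prop where
  length_nonneg : 0 ≤ ℓ
  continuousOn : ContinuousOn p (Set.Icc 0 ℓ)
  lower : ∀ s ∈ Set.Icc 0 ℓ, ∀ t ∈ Set.Icc 0 ℓ, dist s t / lam - C ≤ dist (p s) (p t)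
  upper : ∀ s ∈ Set.Icc 0 ℓ, ∀ t ∈ Set.Icc 0 ℓ, dist (p s) (p t) ≤ lam * dist s t + C

/-- A subset `T` of a metric space is Morse if for all `lam ≥ 1`, `C ≥ 0` there is `N` such that
every `(lam, C)`-quasi-geodesic with endpoints in `T` lies in the `N`-neighbourhood of `T`. -/
def IsMorse {S : Type*} [PseudoMetricSpace S] (T : Set S) : Prop :=
  ∀ lam C : ℝ, 1 ≤ lam → 0 ≤ C → ∃ N : ℝ, ∀ (ℓ : ℝ) (p : ℝ → S), IsQuasiGeodesic lam C ℓ p →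
    p 0 ∈ T → p ℓ ∈ T → ∀ t ∈ Set.Icc 0 ℓ, p t ∈ Metric.thickening N T

/-- The subgroup `H` is strongly quasi-convex: it is Morse in the Cayley graph `Γ(G, X)`. -/
def IsStronglyQuasiConvex {G : Type*} [Group G] (X : FiniteGeneratingSet G)
    (H : Subgroup G) : Prop :=
  IsMorse (CayleyGraph.vertex X '' (H : Set G))

/-- A subset `T` of a topological space is strongly convex if every simple (i.e. injective) path
with endpoints in `T` lies in `T`. -/
def IsStronglyConvex {S : Type*} [TopologicalSpace S] (T : Set S) : Prop :=
  ∀ (x y : S) (γ : Path x y), Function.Injective γ → x ∈ T → y ∈ T → Set.range γ ⊆ T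

/-! ### Asymptotic cones -/

/-- A scaling sequence: a strictly increasing, unbounded sequence of positive real numbers. -/
structure ScalingSequence where
  toFun : ℕ → ℝ
  pos : ∀ i, 0 < toFun i
  strictMono : StrictMono toFun
  tendsto : Tendsto toFun atTop atTop

instance : CoeFun ScalingSequence (fun _ => ℕ → ℝ) := ⟨ScalingSequence.toFun⟩

/-- The sequences `t` in `S` such that `dist (z i) (t i) / c i` is bounded, where `z` is the
observation point. The ultrafilter `ω` does not occur in this condition; it determines the
pseudometric on this type. -/
structure ConeSequence (S : Type*) [PseudoMetricSpace S] (ω : Ultrafilter ℕ) (c : ScalingSequence)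
    (z : ℕ → S) where
  seq : ℕ → S
  bounded : ∃ B : ℝ, ∀ i, dist (z i) (seq i) / c i ≤ B

theorem ConeSequence.tendsto_lim {S : Type*} [PseudoMetricSpace S] {ω : Ultrafilter ℕ}
    {c : ScalingSequence} {z : ℕ → S} (x y : ConeSequence S ω c z) :
    Tendsto (fun i => dist (x.seq i) (y.seq i) / c i) ω
      (𝓝 (limUnder (ω : Filter ℕ) fun i => dist (x.seq i) (y.seq i) / c i)) := by
  apply tendsto_nhds_limUnder
  obtain ⟨A, hA⟩ := x.bounded
  obtain ⟨B, hB⟩ := y.bounded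
  have hmem : ∀ i, dist (x.seq i) (y.seq i) / c i ∈ Set.Icc 0 (A + B) := fun i => by
    refine ⟨div_nonneg dist_nonneg (c.pos i).le, ?_⟩
    calc dist (x.seq i) (y.seq i) / c i
        ≤ (dist (z i) (x.seq i) + dist (z i) (y.seq i)) / c i :=
          div_le_div_of_nonneg_right (dist_triangle_left _ _ _) (c.pos i).le
      _ ≤ A + B := by rw [add_div]; exact add_le_add (hA i) (hB i)
  obtain ⟨a, -, ha⟩ := (isCompact_Icc (a := (0 : ℝ)) (b := A + B)).ultrafilter_le_nhds
    (ω.map fun i => dist (x.seq i) (y.seq i) / c i)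
    (le_principal_iff.mpr (Ultrafilter.mem_map.mpr (Filter.univ_mem' hmem)))
  exact ⟨a, ha⟩

/-- The pseudometric `lim^ω dist (x i) (y i) / c i`. -/
instance {S : Type*} [PseudoMetricSpace S] (ω : Ultrafilter ℕ) (c : ScalingSequence)
    (z : ℕ → S) : PseudoMetricSpace (ConeSequence S ω c z) where
  dist x y := limUnder (ω : Filter ℕ) fun i => dist (x.seq i) (y.seq i) / c i
  dist_self x := by
    refine tendsto_nhds_unique (x.tendsto_lim x) ?_
    simp
  dist_comm x y := by simp only [dist_comm]
  dist_triangle x y w := by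
    refine le_of_tendsto_of_tendsto' (x.tendsto_lim w)
      ((x.tendsto_lim y).add (y.tendsto_lim w)) fun i => ?_
    rw [← add_div]
    exact div_le_div_of_nonneg_right (dist_triangle _ _ _) (c.pos i).le

/-- The asymptotic cone of `S` with respect to the ultrafilter `ω`, the scaling sequence `c` and
the observation point `z`: sequences at distance zero are identified. -/
abbrev Cone (S : Type*) [PseudoMetricSpace S] (ω : Ultrafilter ℕ) (c : ScalingSequence)
    (z : ℕ → S) : Type _ :=
  SeparationQuotient (ConeSequence S ω c z)

/-- The points of the asymptotic cone of `S` that have a representative with all components in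
`T`. -/
def subspaceCone {S : Type*} [PseudoMetricSpace S] (ω : Ultrafilter ℕ) (c : ScalingSequence)
    (z : ℕ → S) (T : Set S) : Set (Cone S ω c z) :=
  {x | ∃ t : ConeSequence S ω c z, (∀ i, t.seq i ∈ T) ∧ SeparationQuotient.mk t = x}

/-- The scaling sequence `1, 2, 3, …` (indexed from `0`). -/
def linearScaling : ScalingSequence where
  toFun i := (i : ℝ) + 1
  pos i := by positivity
  strictMono i j h := by simpa using h
  tendsto := tendsto_atTop_add_const_right _ _ tendsto_natCast_atTop_atTop

/-- `Cone^ω(G)`: the asymptotic cone of `G` with the word metric of `X`, the scaling sequence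
`1, 2, 3, …` and the identity as constant observation point. -/
abbrev GroupAsymptoticCone {G : Type*} [Group G] (X : FiniteGeneratingSet G)
    (ω : Ultrafilter ℕ) : Type _ :=
  Cone (WordSpace X) ω linearScaling (fun _ => ⟨1⟩)

/-- `Cone^ω_G(H)`: the points of `Cone^ω(G)` with a representative in `H`. -/
def subgroupCone {G : Type*} [Group G] (X : FiniteGeneratingSet G)
    (ω : Ultrafilter ℕ) (H : Subgroup G) : Set (GroupAsymptoticCone X ω) :=
  subspaceCone ω linearScaling (fun _ => ⟨1⟩) {g : WordSpace X | g.val ∈ H}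

end

/-!
Both directions rest on one construction, which turns walks into quasi-geodesics. Let `S` be a set
of group elements, let steps inside `S` weigh `1` and all other steps weigh `Λ`, and take a walk `q`
of least weight between two points that are joined inside `S` by a walk of length `r`. The number
of steps of `q` between two of its vertices is at most the weight of a geodesic between them, hence
at most `Λ` times their distance, so `q` is a quasi-geodesic whose constants depend only on `Λ`. Its
total weight is at most `r`, so `q` has at most `r` steps and leaves `S` by at most `r / Λ`, which is
as small a fraction of `r` as desired (`JoinedWithin.exists_isDiscreteQuasiGeodesic`).

*Morse subgroups have strongly convex cones.* If a simple path in the cone leaves the cone of `H`,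
some subarc meets that closed set only in its two distinct endpoints. At scale `c i`, let `S` consist
of two small balls around the endpoints and of all elements at distance at least `δ * c i` from `H`.
As the arc is compact, the endpoints are joined inside `S` by walks of length at most a fixed
multiple of `c i`. The construction then gives a quasi-geodesic with endpoints in `H` that stays close
to `S`. It cannot jump from one ball to the other, so it goes far away from `H`, against the Morse
property (`IsDiscretelyMorse.eq_of_path`).

*Strongly convex cones imply the Morse property.* Otherwise there are quasi-geodesics with endpoints
in `H` whose greatest distance `D` from `H` is arbitrarily large, but their lengths need not be
comparable to `D`. Cutting out a part of length comparable to `D` around a point that is almost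
farthest from `H`, joining its ends to `H` by geodesics, and applying the construction gives
quasi-geodesics of length at most `L * D` with endpoints in `H` that still reach distance `D / 2`
from `H` (`exists_isDiscreteQuasiGeodesic_of_coarse`). For an ultrafilter concentrated on these
scales their limit is a bi-Lipschitz, hence simple, path in the cone which starts and ends in the
cone of `H` and leaves it (`not_isStronglyConvex_subspaceCone`). Multiplication by an element of `H`
moves the starting points to the observation point.
-/

/-! ### Shortest walks for a weight that favours a set -/

/-- `WeightedWalk w n x y`: some walk from `x` to `y` with steps of length at most `1` has total
weight `n`, where the step from `u` to `v` weighs `w u v`. -/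
inductive WeightedWalk {E : Type*} [PseudoMetricSpace E] (w : E → E → ℕ) : ℕ → E → E → Prop
  | nil (x : E) : WeightedWalk w 0 x x
  | snoc {n : ℕ} {x y z : E} : WeightedWalk w n x y → dist y z ≤ 1 →
      WeightedWalk w (n + w y z) x z

open Classical in
/-- The weight `1` for steps inside `S`, and `Λ` for all others. -/
noncomputable def cheapWeight {E : Type*} (S : Set E) (Λ : ℕ) (u v : E) : ℕ :=
  if u ∈ S ∧ v ∈ S then 1 else Λ

/-- `x` and `y` are joined by a walk of weight at most `r`, where steps inside `S` weigh `1` and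
all others weigh `Λ`. -/
def JoinedWithin {E : Type*} [PseudoMetricSpace E] (S : Set E) (Λ : ℕ) (r : ℝ) (x y : E) : Prop :=
  ∃ n : ℕ, (n : ℝ) ≤ r ∧ WeightedWalk (cheapWeight S Λ) n x y

/-- The vertices `q 0, …, q m` form a walk with steps of length at most `1` along which the
distance between two vertices is at least `Λ⁻¹` times the number of steps between them. -/
structure IsDiscreteQuasiGeodesic {E : Type*} [PseudoMetricSpace E] (Λ m : ℕ) (q : ℕ → E) :
    Prop where
  step : ∀ k < m, dist (q k) (q (k + 1)) ≤ 1
  lower : ∀ i ≤ m, ∀ j ≤ m, |(i : ℝ) - j| ≤ Λ * dist (q i) (q j)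

theorem cheapWeight_comm {E : Type*} (S : Set E) (Λ : ℕ) (u v : E) :
    cheapWeight S Λ u v = cheapWeight S Λ v u := by
  unfold cheapWeight; split_ifs <;> tauto

theorem one_le_cheapWeight {E : Type*} (S : Set E) {Λ : ℕ} (hΛ : 1 ≤ Λ) (u v : E) :
    1 ≤ cheapWeight S Λ u v := by
  unfold cheapWeight; split_ifs <;> omega

theorem cheapWeight_le {E : Type*} (S : Set E) {Λ : ℕ} (hΛ : 1 ≤ Λ) (u v : E) :
    cheapWeight S Λ u v ≤ Λ := by
  unfold cheapWeight; split_ifs <;> omega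

section Walks

variable {E : Type*} [PseudoMetricSpace E]

namespace WeightedWalk

variable {w : E → E → ℕ}

theorem trans {n m : ℕ} {x y z : E} (h : WeightedWalk w n x y) (h' : WeightedWalk w m y z) :
    WeightedWalk w (n + m) x z := by
  induction h' with
  | nil => exact h
  | snoc _ hd ih => rw [← add_assoc]; exact (ih h).snoc hd

theorem single {x y : E} (h : dist x y ≤ 1) : WeightedWalk w (w x y) x y := by
  simpa using (nil x).snoc h

theorem symm (hw : ∀ u v, w u v = w v u) {n : ℕ} {x y : E} (h : WeightedWalk w n x y) :
    WeightedWalk w n y x := by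
  induction h with
  | nil x => exact nil x
  | @snoc n x y z _ hd ih =>
    rw [add_comm, hw y z]
    exact (single (by rwa [dist_comm])).trans ih

theorem exists_seq {n : ℕ} {x y : E} (h : WeightedWalk w n x y) :
    ∃ (m : ℕ) (q : ℕ → E), q 0 = x ∧ q m = y ∧ (∀ k < m, dist (q k) (q (k + 1)) ≤ 1) ∧
      ∑ k ∈ Finset.range m, w (q k) (q (k + 1)) = n := by
  induction h with
  | nil x => exact ⟨0, fun _ => x, rfl, rfl, by simp, by simp⟩
  | @snoc n x y z _ hd ih =>
    obtain ⟨m, q, h0, hm, hs, hc⟩ := ih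
    have hlt : ∀ k, k < m → (fun k => if k ≤ m then q k else z) k = q k ∧
        (fun k => if k ≤ m then q k else z) (k + 1) = q (k + 1) := fun k hk =>
      ⟨if_pos hk.le, if_pos hk⟩
    refine ⟨m + 1, fun k => if k ≤ m then q k else z, by simpa using h0, by simp, ?_, ?_⟩
    · intro k hk
      rcases Nat.lt_succ_iff_lt_or_eq.mp hk with hk | rfl
      · rw [(hlt k hk).1, (hlt k hk).2]; exact hs k hk
      · simpa [hm] using hd
    · rw [Finset.sum_range_succ, Finset.sum_congr rfl fun k hk => by
        rw [(hlt k (Finset.mem_range.mp hk)).1, (hlt k (Finset.mem_range.mp hk)).2], hc]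
      simp [hm]

theorem of_seq {m : ℕ} {q : ℕ → E} (hs : ∀ k < m, dist (q k) (q (k + 1)) ≤ 1) {i j : ℕ}
    (hij : i ≤ j) (hj : j ≤ m) :
    WeightedWalk w (∑ k ∈ Finset.Ico i j, w (q k) (q (k + 1))) (q i) (q j) := by
  induction j, hij using Nat.le_induction with
  | base => simpa using nil (q i)
  | succ j hij ih =>
    rw [Finset.sum_Ico_succ_top hij]
    exact (ih (by omega)).snoc (hs j (by omega))

end WeightedWalk

namespace JoinedWithin

variable {S : Set E} {Λ : ℕ}

theorem trans {r r' : ℝ} {x y z : E} (h : JoinedWithin S Λ r x y) (h' : JoinedWithin S Λ r' y z) :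
    JoinedWithin S Λ (r + r') x z := by
  obtain ⟨n, hn, h⟩ := h
  obtain ⟨m, hm, h'⟩ := h'
  exact ⟨n + m, by push_cast; linarith, h.trans h'⟩

theorem symm {r : ℝ} {x y : E} (h : JoinedWithin S Λ r x y) : JoinedWithin S Λ r y x := by
  obtain ⟨n, hn, h⟩ := h
  exact ⟨n, hn, h.symm (cheapWeight_comm S Λ)⟩

theorem mono {r r' : ℝ} {x y : E} (h : JoinedWithin S Λ r x y) (hr : r ≤ r') :
    JoinedWithin S Λ r' x y := by
  obtain ⟨n, hn, h⟩ := h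
  exact ⟨n, hn.trans hr, h⟩

end JoinedWithin

/-- `E` has integral distances, and every two points are joined by a geodesic sequence of unit
steps (given by induction: a point can be brought one unit closer to another). -/
def HasUnitGeodesics (E : Type*) [PseudoMetricSpace E] : Prop :=
  (∀ u v : E, ∃ n : ℕ, dist u v = n) ∧
    ∀ (u v : E) (n : ℕ), dist u v = n + 1 → ∃ v', dist u v' = n ∧ dist v' v ≤ 1

end Walks

section Shortest

variable {E : Type*} [MetricSpace E]

theorem HasUnitGeodesics.exists_weightedWalk (hE : HasUnitGeodesics E) {u : E}
    (w : E → E → ℕ) (c : ℕ) (n : ℕ) (v : E) (hv : dist u v = n)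
    (hw : ∀ a b, dist u a ≤ n → dist u b ≤ n → w a b ≤ c) :
    ∃ k ≤ c * n, WeightedWalk w k u v := by
  induction n generalizing v with
  | zero =>
    obtain rfl : u = v := dist_eq_zero.mp (by simpa using hv)
    exact ⟨0, by simp, .nil u⟩
  | succ n ih =>
    obtain ⟨v', h1, h2⟩ := hE.2 u v n (by simpa using hv)
    obtain ⟨k, hk, hwalk⟩ := ih v' h1 fun a b ha hb =>
      hw a b (ha.trans (by simp)) (hb.trans (by simp))
    refine ⟨k + w v' v, ?_, hwalk.snoc h2⟩
    have := hw v' v (by rw [h1]; simp) hv.le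
    rw [mul_add, mul_one]
    omega

/-- Two points are joined inside `S` by a geodesic if a large enough ball around the first point
is contained in `S`. -/
theorem HasUnitGeodesics.joinedWithin (hE : HasUnitGeodesics E) {S : Set E} {Λ : ℕ} {r : ℝ}
    {u v : E} (h : dist u v ≤ r) (hS : Metric.closedBall u r ⊆ S) : JoinedWithin S Λ r u v := by
  obtain ⟨n, hn⟩ := hE.1 u v
  obtain ⟨k, hk, hwalk⟩ := hE.exists_weightedWalk (cheapWeight S Λ) 1 n v hn fun a b ha hb => by
    have hab : ∀ z, dist u z ≤ n → z ∈ S := fun z hz =>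
      hS (by rw [Metric.mem_closedBall, dist_comm]; exact hz.trans (hn ▸ h))
    exact (if_pos ⟨hab a ha, hab b hb⟩).le
  refine ⟨k, ?_, hwalk⟩
  calc (k : ℝ) ≤ n := by exact_mod_cast (by simpa using hk)
    _ ≤ r := hn ▸ h

/-- Taking a walk of least weight turns a walk inside `S` into a discrete quasi-geodesic which is
not longer and stays close to `S`. The constant `Λ` can be chosen freely: the larger it is, the
closer to `S` the quasi-geodesic stays. -/
theorem JoinedWithin.exists_isDiscreteQuasiGeodesic (hE : HasUnitGeodesics E) {S : Set E} {Λ : ℕ}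
    (hΛ : 1 ≤ Λ) {r : ℝ} {x y : E} (hx : x ∈ S) (h : JoinedWithin S Λ r x y) :
    ∃ (m : ℕ) (q : ℕ → E), (m : ℝ) ≤ r ∧ q 0 = x ∧ q m = y ∧ IsDiscreteQuasiGeodesic Λ m q ∧
      ∀ i ≤ m, ∃ s ∈ S, Λ * dist (q i) s ≤ r := by
  classical
  obtain ⟨n, hn, hwalk⟩ := h
  have hex : ∃ n, WeightedWalk (cheapWeight S Λ) n x y := ⟨n, hwalk⟩
  obtain ⟨m, q, h0, hm, hs, hc⟩ := (Nat.find_spec hex).exists_seq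
  have hmin : Nat.find hex ≤ n := Nat.find_min' hex hwalk
  set w := cheapWeight S Λ with hw
  set f : ℕ → ℕ := fun k => w (q k) (q (k + 1)) with hf
  -- Subwalks of a walk of least weight have least weight.
  have hsub : ∀ i j, i ≤ j → j ≤ m → ∀ c, WeightedWalk w c (q i) (q j) →
      ∑ k ∈ Finset.Ico i j, f k ≤ c := by
    intro i j hij hj c hcw
    have h1 := WeightedWalk.of_seq (w := w) hs (Nat.zero_le i) (hij.trans hj)
    have h2 := WeightedWalk.of_seq (w := w) hs hj le_rfl
    rw [h0] at h1
    rw [hm] at h2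
    have h3 := Nat.find_min' hex ((h1.trans hcw).trans h2)
    rw [← hc, Finset.range_eq_Ico, ← Finset.sum_Ico_consecutive f (Nat.zero_le i) (hij.trans hj),
      ← Finset.sum_Ico_consecutive f hij hj] at h3
    simp only [hf] at h3 ⊢
    omega
  have hlen : ∀ i j, i ≤ j → j - i ≤ ∑ k ∈ Finset.Ico i j, f k := fun i j hij => by
    have := Finset.card_nsmul_le_sum (Finset.Ico i j) f 1 fun k _ => one_le_cheapWeight S hΛ _ _
    simpa using this
  have hlow : ∀ i j, i ≤ j → j ≤ m → (j : ℝ) - i ≤ Λ * dist (q i) (q j) := by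
    intro i j hij hj
    obtain ⟨d, hd⟩ := hE.1 (q i) (q j)
    obtain ⟨k, hk, hkw⟩ := hE.exists_weightedWalk w Λ d (q j) hd fun a b _ _ =>
      cheapWeight_le S hΛ a b
    have := (hlen i j hij).trans ((hsub i j hij hj k hkw).trans hk)
    rw [hd]
    rw [Nat.sub_le_iff_le_add] at this
    have h' : (j : ℝ) ≤ Λ * d + i := by exact_mod_cast this
    linarith
  refine ⟨m, q, ?_, h0, hm, ⟨hs, fun i hi j hj => ?_⟩, fun i hi => ?_⟩
  · have := hlen 0 m (Nat.zero_le m)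
    rw [← Finset.range_eq_Ico, hc, Nat.sub_zero] at this
    exact le_trans (by exact_mod_cast this.trans hmin) hn
  · rcases le_total i j with hij | hij
    · rw [abs_sub_comm, abs_of_nonneg (by simpa using hij)]
      exact hlow i j hij hj
    · rw [abs_of_nonneg (by simpa using hij), dist_comm]
      exact hlow j i hij hi
  · -- Each step to a vertex outside `S` weighs `Λ`, and moves at most one unit away from `S`.
    have key : ∀ i ≤ m, ∃ s ∈ S, Λ * dist (q i) s ≤ ((∑ k ∈ Finset.range i, f k : ℕ) : ℝ) := by
      intro i
      induction i with
      | zero => exact fun _ => ⟨x, hx, by simp [h0]⟩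
      | succ i ih =>
        intro hi
        by_cases hq : q (i + 1) ∈ S
        · exact ⟨_, hq, by rw [dist_self, mul_zero]; positivity⟩
        · obtain ⟨s, hsS, hle⟩ := ih (by omega)
          refine ⟨s, hsS, ?_⟩
          have hfi : f i = Λ := if_neg fun h => hq h.2
          rw [Finset.sum_range_succ, hfi]
          push_cast at hle ⊢
          have h1 := hs i (by omega)
          have h2 := dist_triangle_left (q (i + 1)) s (q i)
          have hΛ0 : (0 : ℝ) ≤ Λ := by positivity
          nlinarith
    obtain ⟨s, hsS, hle⟩ := key i hi
    refine ⟨s, hsS, hle.trans (le_trans ?_ hn)⟩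
    have : ∑ k ∈ Finset.range i, f k ≤ ∑ k ∈ Finset.range m, f k :=
      Finset.sum_le_sum_of_subset (Finset.range_mono hi)
    exact_mod_cast (this.trans_eq hc).trans hmin

end Shortest

/-! ### The word metric and the Cayley graph -/

section Cayley

variable {G : Type*} [Group G] {X : FiniteGeneratingSet G}

theorem WordSpace.dist_eq (u v : WordSpace X) :
    dist u v = (wordLength X.carrier (u.val⁻¹ * v.val) : ℝ) := rfl

theorem WordSpace.dist_mul_left (g : G) (u v : WordSpace X) :
    dist (WordSpace.mk (X := X) (g * u.val)) (WordSpace.mk (g * v.val)) = dist u v := by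
  simp only [WordSpace.dist_eq, mul_inv_rev, mul_assoc, inv_mul_cancel_left]

theorem WordSpace.hasUnitGeodesics : HasUnitGeodesics (WordSpace X) := by
  refine ⟨fun u v => ⟨_, rfl⟩, fun u v n huv => ?_⟩
  have hn : wordLength X.carrier (u.val⁻¹ * v.val) = n + 1 := by
    rw [WordSpace.dist_eq] at huv
    exact_mod_cast huv
  obtain ⟨l, hl, hprod, hlen⟩ := exists_word X.closure_eq_top (u.val⁻¹ * v.val)
  obtain rfl | ⟨l', x, rfl⟩ := List.eq_nil_or_concat' l
  · simp [hn] at hlen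
  have hl' : l'.length = n := by simpa [hn] using hlen
  have h1 : dist u (WordSpace.mk (X := X) (u.val * l'.prod)) ≤ n := by
    rw [WordSpace.dist_eq, inv_mul_cancel_left, ← hl']
    exact_mod_cast wordLength_prod_le fun y hy => hl y (by simp [hy])
  have h2 : dist (WordSpace.mk (X := X) (u.val * l'.prod)) v ≤ 1 := by
    have hx : (u.val * l'.prod)⁻¹ * v.val = [x].prod := by
      rw [mul_inv_rev, mul_assoc, ← hprod]
      simp
    rw [WordSpace.dist_eq, hx]
    exact_mod_cast wordLength_prod_le (l := [x]) fun y hy => hl y (by simp_all)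
  have h3 := dist_triangle u (WordSpace.mk (X := X) (u.val * l'.prod)) v
  exact ⟨_, le_antisymm h1 (by linarith), h2⟩

namespace CayleyGraph

theorem dist_vertex (u v : WordSpace X) :
    dist (vertex X u.val) (vertex X v.val) = dist u v := by
  refine le_antisymm ?_ (CayleyPoint.le_distThroughVertex fun w => dist_triangle_right _ _ _)
  refine (CayleyPoint.distThroughVertex_le _ _ v).trans ?_
  simp [CayleyPoint.distToVertex]

theorem dist_edge_le (g : G) (x : X.carrier) (s t : unitInterval) :
    dist (SeparationQuotient.mk (CayleyPoint.edge g x s) : CayleyGraph X)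
      (SeparationQuotient.mk (CayleyPoint.edge g x t)) ≤ |(s : ℝ) - t| :=
  CayleyPoint.pathDist_edge_le g x s t

theorem mk_edge_zero (g : G) (x : X.carrier) :
    (SeparationQuotient.mk (CayleyPoint.edge g x 0) : CayleyGraph X) = vertex X g := by
  refine dist_le_zero.mp ((CayleyPoint.distThroughVertex_le _ _ (WordSpace.mk g)).trans ?_)
  simp [CayleyPoint.distToVertex]

theorem mk_edge_one (g : G) (x : X.carrier) :
    (SeparationQuotient.mk (CayleyPoint.edge g x 1) : CayleyGraph X) = vertex X (g * x) := by
  refine dist_le_zero.mp ((CayleyPoint.distThroughVertex_le _ _ (WordSpace.mk (g * x))).trans ?_)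
  simp [CayleyPoint.distToVertex]

theorem exists_vertex_dist_le (p : CayleyGraph X) :
    ∃ u : WordSpace X, dist p (vertex X u.val) ≤ 1 := by
  obtain ⟨p, rfl⟩ := SeparationQuotient.surjective_mk p
  rcases p with g | ⟨g, x, t⟩
  · exact ⟨WordSpace.mk g, by rw [vertex, dist_self]; exact zero_le_one⟩
  · refine ⟨WordSpace.mk g, ?_⟩
    rw [← mk_edge_zero g x]
    refine (dist_edge_le g x t 0).trans ?_
    rw [Set.Icc.coe_zero, sub_zero, abs_of_nonneg t.2.1]
    exact t.2.2

theorem exists_edge_path_mul (g : G) (x : X.carrier) :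
    ∃ e : ℝ → CayleyGraph X, e 0 = vertex X g ∧ e 1 = vertex X (g * x) ∧
      ∀ s ∈ Set.Icc (0 : ℝ) 1, ∀ t ∈ Set.Icc (0 : ℝ) 1, dist (e s) (e t) ≤ |s - t| := by
  refine ⟨fun t => SeparationQuotient.mk (CayleyPoint.edge g x (Set.projIcc 0 1 zero_le_one t)),
    ?_, ?_, fun s hs t ht => ?_⟩
  · simp only [Set.projIcc_left]; exact mk_edge_zero g x
  · simp only [Set.projIcc_right]; exact mk_edge_one g x
  · refine (dist_edge_le g x _ _).trans ?_
    rw [Set.projIcc_of_mem zero_le_one hs, Set.projIcc_of_mem zero_le_one ht]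

theorem exists_edge_path {u v : WordSpace X} (h : dist u v ≤ 1) :
    ∃ e : ℝ → CayleyGraph X, e 0 = vertex X u.val ∧ e 1 = vertex X v.val ∧
      ∀ s ∈ Set.Icc (0 : ℝ) 1, ∀ t ∈ Set.Icc (0 : ℝ) 1, dist (e s) (e t) ≤ |s - t| := by
  obtain ⟨l, hl, hprod, hlen⟩ := exists_word X.closure_eq_top (u.val⁻¹ * v.val)
  have hle : l.length ≤ 1 := by
    rw [hlen]
    rw [WordSpace.dist_eq] at h
    exact_mod_cast h
  rcases l with _ | ⟨x, _ | ⟨y, l⟩⟩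
  · have huv : u.val = v.val := inv_mul_eq_one.mp hprod.symm
    exact ⟨fun _ => vertex X u.val, rfl, by rw [huv], fun s _ t _ => by simp⟩
  · have hx : u.val * x = v.val := by
      rw [List.prod_singleton] at hprod
      rw [hprod, mul_inv_cancel_left]
    rcases hl x (by simp) with hX | hX
    · obtain ⟨e, h0, h1, he⟩ := exists_edge_path_mul u.val ⟨x, hX⟩
      exact ⟨e, h0, by rw [h1, ← hx], he⟩
    · obtain ⟨e, h0, h1, he⟩ := exists_edge_path_mul v.val ⟨x⁻¹, hX⟩
      refine ⟨fun t => e (1 - t), ?_, by simpa using h0, fun s hs t ht => ?_⟩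
      · simp [h1, ← hx]
      · refine (he _ ⟨by linarith [hs.2], by linarith [hs.1]⟩ _
          ⟨by linarith [ht.2], by linarith [ht.1]⟩).trans ?_
        rw [sub_sub_sub_cancel_left, abs_sub_comm]
  · simp at hle

/-- A walk in the group extends to a `1`-Lipschitz path in the Cayley graph. -/
theorem exists_lipschitz_path {q : ℕ → WordSpace X} (hq : ∀ k, dist (q k) (q (k + 1)) ≤ 1) :
    ∃ p : ℝ → CayleyGraph X, (∀ k : ℕ, p k = vertex X (q k).val) ∧
      ∀ s t, 0 ≤ s → 0 ≤ t → dist (p s) (p t) ≤ |s - t| := by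
  choose e h0 h1 he using fun k => exists_edge_path (hq k)
  have hvert : ∀ i j, i ≤ j → dist (vertex X (q i).val) (vertex X (q j).val) ≤ (j : ℝ) - i := by
    intro i j hij
    rw [dist_vertex]
    refine (dist_le_Ico_sum_dist q hij).trans ((Finset.sum_le_card_nsmul _ _ 1 fun k _ => hq k).trans ?_)
    simp [Nat.cast_sub hij]
  have key : ∀ s t, 0 ≤ s → s ≤ t → dist (e ⌊s⌋₊ (s - ⌊s⌋₊)) (e ⌊t⌋₊ (t - ⌊t⌋₊)) ≤ t - s := by
    intro s t hs hst
    have mem : ∀ r : ℝ, 0 ≤ r → r - ⌊r⌋₊ ∈ Set.Icc (0 : ℝ) 1 := fun r hr =>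
      ⟨by linarith [Nat.floor_le hr], by linarith [Nat.lt_floor_add_one r]⟩
    rcases (Nat.floor_le_floor hst).eq_or_lt with hf | hf
    · have := he ⌊s⌋₊ _ (mem s hs) (t - ⌊s⌋₊) (hf ▸ mem t (hs.trans hst))
      rw [← hf]
      rwa [sub_sub_sub_cancel_right, abs_sub_comm, abs_of_nonneg (by linarith)] at this
    · have a1 := he ⌊s⌋₊ _ (mem s hs) 1 (by simp)
      have a2 := hvert (⌊s⌋₊ + 1) ⌊t⌋₊ hf
      have a3 := he ⌊t⌋₊ 0 (by simp) _ (mem t (hs.trans hst))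
      rw [h1, abs_sub_comm, abs_of_nonneg (by linarith [(mem s hs).2])] at a1
      rw [h0, zero_sub, abs_neg, abs_of_nonneg (mem t (hs.trans hst)).1] at a3
      refine (dist_triangle4 _ _ _ _).trans ((add_le_add_three a1 a2 a3).trans ?_)
      push_cast
      linarith
  refine ⟨fun t => e ⌊t⌋₊ (t - ⌊t⌋₊), fun k => by simp [h0], fun s t hs ht => ?_⟩
  rcases le_total s t with hst | hst
  · rw [abs_sub_comm, abs_of_nonneg (by linarith)]
    exact key s t hs hst
  · rw [abs_of_nonneg (by linarith), dist_comm]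
    exact key t s ht hst

end CayleyGraph

/-- Interpolation along edges: points of the path are at distance at most `1` from the vertices at
the integral times below, so `3` bounds the additive error. -/
theorem IsDiscreteQuasiGeodesic.exists_isQuasiGeodesic {Λ m : ℕ} {q : ℕ → WordSpace X}
    (hΛ : 1 ≤ Λ) (hq : IsDiscreteQuasiGeodesic Λ m q) :
    ∃ p : ℝ → CayleyGraph X, (∀ k : ℕ, k ≤ m → p k = CayleyGraph.vertex X (q k).val) ∧
      IsQuasiGeodesic (Λ : ℝ) 3 m p := by
  have hΛ' : (1 : ℝ) ≤ Λ := by exact_mod_cast hΛ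
  -- Beyond `m` the walk is made constant, since nothing is known about its steps there.
  obtain ⟨p, hp, hlip⟩ := CayleyGraph.exists_lipschitz_path (X := X) (q := fun k => q (min k m))
    fun k => by
      rcases lt_or_ge k m with hk | hk
      · simpa [hk.le, Nat.succ_le_of_lt hk] using hq.step k hk
      · simp [hk, hk.trans (Nat.le_succ k)]
  refine ⟨p, fun k hk => by rw [hp, min_eq_left hk], Nat.cast_nonneg m, ?_, ?_, ?_⟩
  · refine LipschitzOnWith.continuousOn (K := 1) (LipschitzOnWith.of_dist_le_mul ?_)
    intro s hs t ht
    simpa [Real.dist_eq] using hlip s t hs.1 ht.1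
  · intro s hs t ht
    have hfl : ∀ r ∈ Set.Icc (0 : ℝ) m, ⌊r⌋₊ ≤ m := fun r hr => Nat.floor_le_of_le hr.2
    have hd : ∀ r ∈ Set.Icc (0 : ℝ) m, |r - ⌊r⌋₊| ≤ 1 := fun r hr => by
      rw [abs_of_nonneg (by linarith [Nat.floor_le hr.1])]
      linarith [Nat.lt_floor_add_one r]
    have a1 := hq.lower _ (hfl s hs) _ (hfl t ht)
    have a2 := hlip _ _ (Nat.cast_nonneg ⌊s⌋₊) hs.1
    have a3 := hlip _ _ ht.1 (Nat.cast_nonneg ⌊t⌋₊)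
    have a4 := dist_triangle4 (p ⌊s⌋₊) (p s) (p t) (p ⌊t⌋₊)
    have h1 := hd s hs
    have h2 := hd t ht
    rw [hp, hp, min_eq_left (hfl s hs), min_eq_left (hfl t ht), CayleyGraph.dist_vertex] at a4
    rw [hp, min_eq_left (hfl s hs), abs_sub_comm] at a2
    rw [hp, min_eq_left (hfl t ht)] at a3
    have h3 : |s - t| ≤ |(⌊s⌋₊ : ℝ) - ⌊t⌋₊| + 1 := by
      rw [abs_le]
      have b1 := Nat.floor_le hs.1
      have b2 := Nat.lt_floor_add_one s
      have b3 := Nat.floor_le ht.1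
      have b4 := Nat.lt_floor_add_one t
      have b5 := le_abs_self ((⌊s⌋₊ : ℝ) - ⌊t⌋₊)
      have b6 := neg_abs_le ((⌊s⌋₊ : ℝ) - ⌊t⌋₊)
      constructor <;> linarith
    rw [sub_le_iff_le_add, div_le_iff₀ (by linarith), Real.dist_eq]
    nlinarith
  · intro s hs t ht
    have := hlip s t hs.1 ht.1
    rw [Real.dist_eq]
    nlinarith [abs_nonneg (s - t)]

/-- The discrete form of the Morse property of a subset `T`: only walks with unit steps are
considered. -/
def IsDiscretelyMorse {E : Type*} [PseudoMetricSpace E] (T : Set E) : Prop :=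
  ∀ Λ : ℕ, 1 ≤ Λ → ∃ N : ℝ, ∀ (m : ℕ) (q : ℕ → E), IsDiscreteQuasiGeodesic Λ m q →
    q 0 ∈ T → q m ∈ T → ∀ k ≤ m, Metric.infDist (q k) T ≤ N

theorem IsStronglyQuasiConvex.isDiscretelyMorse {H : Subgroup G} (h : IsStronglyQuasiConvex X H) :
    IsDiscretelyMorse {g : WordSpace X | g.val ∈ H} := by
  intro Λ hΛ
  obtain ⟨N, hN⟩ := h Λ 3 (by exact_mod_cast hΛ) (by norm_num)
  refine ⟨N, fun m q hq h0 hm k hk => ?_⟩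
  obtain ⟨p, hp, hgeo⟩ := hq.exists_isQuasiGeodesic hΛ
  have hp0 : p 0 = CayleyGraph.vertex X (q 0).val := by simpa using hp 0 (Nat.zero_le m)
  have := hN m p hgeo (hp0 ▸ ⟨_, h0, rfl⟩) (hp m le_rfl ▸ ⟨_, hm, rfl⟩) k
    ⟨Nat.cast_nonneg k, by exact_mod_cast hk⟩
  rw [hp k hk] at this
  obtain ⟨_, ⟨g, hg, rfl⟩, hlt⟩ := Metric.mem_thickening_iff.mp this
  have h2 := CayleyGraph.dist_vertex (q k) (WordSpace.mk (X := X) g)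
  exact (Metric.infDist_le_dist_of_mem (s := {g : WordSpace X | g.val ∈ H}) (y := ⟨g⟩) hg).trans
    (h2 ▸ hlt.le)

end Cayley

/-! ### Asymptotic cones of subsets -/

section Cone

theorem Ultrafilter.le_atTop_of_forall_ne_pure {ω : Ultrafilter ℕ} (h : ∀ n, ω ≠ pure n) :
    (ω : Filter ℕ) ≤ atTop := by
  rw [← Nat.cofinite_eq_atTop]
  exact ω.le_cofinite_or_eq_pure.resolve_right fun ⟨n, hn⟩ => h n hn

variable {E : Type*} [PseudoMetricSpace E] {ω : Ultrafilter ℕ} {c : ScalingSequence} {z : ℕ → E}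

theorem ConeSequence.tendsto_dist (x y : ConeSequence E ω c z) :
    Tendsto (fun i => dist (x.seq i) (y.seq i) / c i) ω
      (𝓝 (dist (SeparationQuotient.mk x : Cone E ω c z) (SeparationQuotient.mk y))) :=
  x.tendsto_lim y

theorem ConeSequence.eventually_dist_lt {x y : ConeSequence E ω c z} {r : ℝ}
    (h : dist (SeparationQuotient.mk x : Cone E ω c z) (SeparationQuotient.mk y) < r) :
    ∀ᶠ i in (ω : Filter ℕ), dist (x.seq i) (y.seq i) < r * c i :=
  ((x.tendsto_dist y).eventually_lt_const h).mono fun i hi => (div_lt_iff₀ (c.pos i)).mp hi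

theorem ConeSequence.eventually_lt_dist {x y : ConeSequence E ω c z} {r : ℝ}
    (h : r < dist (SeparationQuotient.mk x : Cone E ω c z) (SeparationQuotient.mk y)) :
    ∀ᶠ i in (ω : Filter ℕ), r * c i < dist (x.seq i) (y.seq i) :=
  ((x.tendsto_dist y).eventually_const_lt h).mono fun i hi => (lt_div_iff₀ (c.pos i)).mp hi

theorem ScalingSequence.eventually_lt_mul (hω : (ω : Filter ℕ) ≤ atTop) {r : ℝ} (hr : 0 < r)
    (A : ℝ) : ∀ᶠ i in (ω : Filter ℕ), A < r * c i :=
  ((c.tendsto.mono_left hω).const_mul_atTop hr).eventually_gt_atTop A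

variable {T : Set E}

/-- Almost nearest points of `T` to the components of a point of the cone. -/
theorem ConeSequence.exists_near (hz : ∀ i, z i ∈ T) (x : ConeSequence E ω c z) :
    ∃ t : ConeSequence E ω c z, (∀ i, t.seq i ∈ T) ∧
      ∀ i, dist (x.seq i) (t.seq i) ≤ Metric.infDist (x.seq i) T + 1 := by
  have hne : T.Nonempty := ⟨z 0, hz 0⟩
  choose t ht hdist using fun i =>
    (Metric.infDist_lt_iff (x := x.seq i) hne).mp (lt_add_one (Metric.infDist (x.seq i) T))
  obtain ⟨B, hB⟩ := x.bounded
  refine ⟨⟨t, 2 * B + 1 / c 0, fun i => ?_⟩, ht, fun i => (hdist i).le⟩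
  have h1 : dist (z i) (t i) ≤ 2 * dist (z i) (x.seq i) + 1 := by
    have := Metric.infDist_le_dist_of_mem (x := x.seq i) (hz i)
    rw [dist_comm] at this
    linarith [dist_triangle (z i) (x.seq i) (t i), hdist i]
  calc dist (z i) (t i) / c i ≤ (2 * dist (z i) (x.seq i) + 1) / c i :=
        div_le_div_of_nonneg_right h1 (c.pos i).le
    _ = 2 * (dist (z i) (x.seq i) / c i) + 1 / c i := by ring
    _ ≤ 2 * B + 1 / c 0 := by
        have := one_div_le_one_div_of_le (c.pos 0) (c.strictMono.monotone (Nat.zero_le i))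
        linarith [hB i]

theorem ConeSequence.dist_le_of_eventually_infDist_le (hω : (ω : Filter ℕ) ≤ atTop)
    {x t : ConeSequence E ω c z}
    (ht : ∀ i, dist (x.seq i) (t.seq i) ≤ Metric.infDist (x.seq i) T + 1) {r : ℝ}
    (h : ∀ᶠ i in (ω : Filter ℕ), Metric.infDist (x.seq i) T ≤ r * c i) :
    dist (SeparationQuotient.mk x : Cone E ω c z) (SeparationQuotient.mk t) ≤ r := by
  refine le_of_forall_pos_le_add fun ε hε => ?_
  refine le_of_tendsto (x.tendsto_dist t) ?_
  filter_upwards [h, c.eventually_lt_mul hω hε 1] with i h1 h2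
  rw [div_le_iff₀ (c.pos i)]
  linarith [ht i]

theorem isClosed_subspaceCone (hω : (ω : Filter ℕ) ≤ atTop) (hz : ∀ i, z i ∈ T) :
    IsClosed (subspaceCone ω c z T) := by
  refine isClosed_of_closure_subset fun x hx => ?_
  obtain ⟨x, rfl⟩ := SeparationQuotient.surjective_mk x
  obtain ⟨t, htT, ht⟩ := x.exists_near hz
  refine ⟨t, htT, Eq.symm (dist_le_zero.mp (le_of_forall_pos_le_add fun ε hε => ?_))⟩
  rw [zero_add]
  refine ConeSequence.dist_le_of_eventually_infDist_le hω ht ?_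
  obtain ⟨_, ⟨y, hyT, rfl⟩, hy⟩ := Metric.mem_closure_iff.mp hx ε hε
  filter_upwards [ConeSequence.eventually_dist_lt hy] with i hi
  exact (Metric.infDist_le_dist_of_mem (hyT i)).trans hi.le

theorem ConeSequence.eventually_lt_infDist (hω : (ω : Filter ℕ) ≤ atTop) (hz : ∀ i, z i ∈ T)
    {x : ConeSequence E ω c z} {r : ℝ}
    (h : r < Metric.infDist (SeparationQuotient.mk x) (subspaceCone ω c z T)) :
    ∀ᶠ i in (ω : Filter ℕ), r * c i < Metric.infDist (x.seq i) T := by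
  by_contra hcon
  rw [← Ultrafilter.eventually_not] at hcon
  obtain ⟨t, htT, ht⟩ := x.exists_near hz
  refine absurd h (not_lt.mpr ?_)
  have htK : SeparationQuotient.mk t ∈ subspaceCone ω c z T := ⟨t, htT, rfl⟩
  refine (Metric.infDist_le_dist_of_mem htK).trans ?_
  exact dist_le_of_eventually_infDist_le hω ht (hcon.mono fun i hi => not_lt.mp hi)

end Cone

/-! ### Morse subsets have strongly convex cones -/

section Convex

variable {E : Type*} [MetricSpace E] {T : Set E} {ω : Ultrafilter ℕ} {c : ScalingSequence}
  {z : ℕ → E}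

/-- A path in the cone is covered by finitely many small balls, so that its points are joined by
walks of linearly bounded length near its components. -/
theorem exists_joinedWithin_of_path (hE : HasUnitGeodesics E) (hω : (ω : Filter ℕ) ≤ atTop)
    (hz : ∀ i, z i ∈ T) {f : ℝ → Cone E ω c z} (hf : Continuous f) {δ : ℝ} (hδ : 0 < δ)
    {g : ℝ → ConeSequence E ω c z} (hg : ∀ t, SeparationQuotient.mk (g t) = f t)
    {S : ℕ → Set E} (hS : ∀ i w, δ * c i ≤ Metric.infDist w T → w ∈ S i) {a b : ℝ}
    (hfar : ∀ t ∈ Set.uIcc a b, 2 * δ < Metric.infDist (f t) (subspaceCone ω c z T)) :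
    ∃ L : ℝ, ∀ Λ : ℕ, ∀ᶠ i in (ω : Filter ℕ),
      JoinedWithin (S i) Λ (L * c i) ((g a).seq i) ((g b).seq i) := by
  refine isPreconnected_uIcc.induction₂ (s := Set.uIcc a b) (fun s t => ∃ L : ℝ, ∀ Λ : ℕ,
    ∀ᶠ i in (ω : Filter ℕ), JoinedWithin (S i) Λ (L * c i) ((g s).seq i) ((g t).seq i))
    ?_ ?_ ?_ Set.left_mem_uIcc Set.right_mem_uIcc
  · intro s hs
    have hnear : ∀ᶠ t in 𝓝 s, dist (f t) (f s) < δ :=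
      hf.continuousAt.eventually (Metric.ball_mem_nhds _ hδ)
    filter_upwards [mem_nhdsWithin_of_mem_nhds hnear] with t ht
    refine ⟨δ, fun Λ => ?_⟩
    have hfs := hfar s hs
    rw [← hg] at hfs
    rw [← hg, ← hg, dist_comm] at ht
    filter_upwards [ConeSequence.eventually_dist_lt ht,
      ConeSequence.eventually_lt_infDist hω hz hfs] with i h1 h2
    refine hE.joinedWithin h1.le fun w hw => hS i w ?_
    have h3 := Metric.infDist_le_infDist_add_dist (s := T) (x := (g s).seq i) (y := w)
    rw [Metric.mem_closedBall, dist_comm] at hw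
    linarith
  · rintro r s t _ _ _ ⟨L, h⟩ ⟨L', h'⟩
    refine ⟨L + L', fun Λ => ?_⟩
    filter_upwards [h Λ, h' Λ] with i h1 h2
    rw [add_mul]
    exact h1.trans h2
  · rintro s t _ _ ⟨L, h⟩
    exact ⟨L, fun Λ => (h Λ).mono fun i hi => hi.symm⟩

/-- The endpoints of an arc that meets the cone of a Morse subset only in its endpoints coincide:
otherwise walks along the arc yield quasi-geodesics that join the neighbourhoods of the two
endpoints away from the subset. -/
theorem IsDiscretelyMorse.eq_of_path (hE : HasUnitGeodesics E) (hT : IsDiscretelyMorse T)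
    (hω : (ω : Filter ℕ) ≤ atTop) (hz : ∀ i, z i ∈ T) {f : ℝ → Cone E ω c z} (hf : Continuous f)
    {a b : ℝ} (hab : a < b) (ha : f a ∈ subspaceCone ω c z T) (hb : f b ∈ subspaceCone ω c z T)
    (hout : ∀ t ∈ Set.Ioo a b, f t ∉ subspaceCone ω c z T) : f a = f b := by
  by_contra hne
  set K := subspaceCone ω c z T with hK
  have hKc : IsClosed K := isClosed_subspaceCone hω hz
  -- Balls of radius `2 * ε` around the endpoints of the arc are more than `ε` apart.
  obtain ⟨ε, hε, hD⟩ : ∃ ε > 0, dist (f a) (f b) = 8 * ε :=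
    ⟨dist (f a) (f b) / 8, by have := dist_pos.mpr hne; positivity, by ring⟩
  obtain ⟨a', ha', haε⟩ : ∃ a' ∈ Set.Ioo a b, dist (f a') (f a) < ε := by
    have h1 : ∀ᶠ t in 𝓝[>] a, dist (f t) (f a) < ε := mem_nhdsWithin_of_mem_nhds
      (hf.continuousAt.eventually (Metric.ball_mem_nhds _ hε))
    obtain ⟨t, h2, h3⟩ := (h1.and (Ioo_mem_nhdsGT hab)).exists
    exact ⟨t, h3, h2⟩
  obtain ⟨b', hb', hbε⟩ : ∃ b' ∈ Set.Ioo a b, dist (f b') (f b) < ε := by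
    have h1 : ∀ᶠ t in 𝓝[<] b, dist (f t) (f b) < ε := mem_nhdsWithin_of_mem_nhds
      (hf.continuousAt.eventually (Metric.ball_mem_nhds _ hε))
    obtain ⟨t, h2, h3⟩ := (h1.and (Ioo_mem_nhdsLT hab)).exists
    exact ⟨t, h3, h2⟩
  have hsub : Set.uIcc a' b' ⊆ Set.Ioo a b := Set.ordConnected_Ioo.uIcc_subset ha' hb'
  obtain ⟨δ, hδ, hfar⟩ : ∃ δ > 0, ∀ t ∈ Set.uIcc a' b', 2 * δ < Metric.infDist (f t) K := by
    obtain ⟨t₀, ht₀, hmin⟩ := isCompact_uIcc.exists_isMinOn (s := Set.uIcc a' b')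
      Set.nonempty_uIcc ((Metric.continuous_infDist_pt K).comp hf).continuousOn
    have hpos := (hKc.notMem_iff_infDist_pos ⟨_, ha⟩).mp (hout t₀ (hsub ht₀))
    refine ⟨Metric.infDist (f t₀) K / 4, by positivity, fun t ht => ?_⟩
    have : Metric.infDist (f t₀) K ≤ Metric.infDist (f t) K := hmin ht
    linarith
  obtain ⟨x, hxT, hx⟩ := ha
  obtain ⟨y, hyT, hy⟩ := hb
  choose g hg using fun t => SeparationQuotient.surjective_mk (f t)
  set S : ℕ → Set E := fun i => {w | dist w (x.seq i) ≤ ε * c i ∨ dist w (y.seq i) ≤ ε * c i ∨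
    δ * c i ≤ Metric.infDist w T} with hS
  obtain ⟨L, hL⟩ := exists_joinedWithin_of_path hE hω hz hf hδ hg (S := S)
    (fun i w hw => Or.inr (Or.inr hw)) hfar
  -- With this `Λ`, walks of length `(ε + L + ε) * c i` stay `η * c i`-close to `S i`.
  set η := min (δ / 2) (ε / 2) with hη
  have hηpos : 0 < η := by positivity
  obtain ⟨Λ, hΛ⟩ := exists_nat_ge (max 1 ((ε + L + ε) / η))
  have hΛ1 : 1 ≤ Λ := by exact_mod_cast (le_max_left _ _).trans hΛ
  have hΛη : ε + L + ε ≤ Λ * η := (div_le_iff₀ hηpos).mp ((le_max_right _ _).trans hΛ)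
  obtain ⟨N, hN⟩ := hT Λ hΛ1
  rw [← hg, ← hx, dist_comm] at haε
  rw [← hg, ← hy] at hbε
  have hDlow : 7 * ε < dist (f a) (f b) := by linarith
  rw [← hx, ← hy] at hDlow
  obtain ⟨i, h1, h2, h3, h4, h5, h6⟩ := (((ConeSequence.eventually_dist_lt haε).and
    ((ConeSequence.eventually_dist_lt hbε).and ((ConeSequence.eventually_lt_dist hDlow).and
    ((hL Λ).and ((c.eventually_lt_mul hω hε 1).and
      (c.eventually_lt_mul hω (half_pos hδ) N)))))).exists)
  have hci := c.pos i
  have j1 : JoinedWithin (S i) Λ (ε * c i) (x.seq i) ((g a').seq i) :=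
    hE.joinedWithin h1.le fun w hw => Or.inl hw
  have j2 : JoinedWithin (S i) Λ (ε * c i) ((g b').seq i) (y.seq i) :=
    (hE.joinedWithin (by rw [dist_comm]; exact h2.le) fun w hw => Or.inr (Or.inl hw)).symm
  have j3 := (j1.trans h4).trans j2
  rw [← add_mul, ← add_mul] at j3
  have hxS : x.seq i ∈ S i := Or.inl (by rw [dist_self]; positivity)
  obtain ⟨m, q, -, q0, qm, hq, hnear⟩ := j3.exists_isDiscreteQuasiGeodesic hE hΛ1 hxS
  have hqN := hN m q hq (q0 ▸ hxT i) (qm ▸ hyT i)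
  have hηc : η * c i ≤ δ / 2 * c i ∧ η * c i ≤ ε / 2 * c i :=
    ⟨mul_le_mul_of_nonneg_right (min_le_left _ _) hci.le,
      mul_le_mul_of_nonneg_right (min_le_right _ _) hci.le⟩
  have hclose : ∀ k ≤ m, dist (q k) (x.seq i) ≤ 2 * ε * c i ∨ dist (q k) (y.seq i) ≤ 2 * ε * c i := by
    intro k hk
    obtain ⟨s, hs, hle⟩ := hnear k hk
    have hΛpos : (0 : ℝ) < Λ := by exact_mod_cast hΛ1
    have hds : dist (q k) s ≤ η * c i := by
      refine le_of_mul_le_mul_left (hle.trans ?_) hΛpos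
      rw [← mul_assoc]
      exact mul_le_mul_of_nonneg_right hΛη hci.le
    rcases hs with hs | hs | hs
    · left; linarith [dist_triangle (q k) s (x.seq i)]
    · right; linarith [dist_triangle (q k) s (y.seq i)]
    · have := Metric.infDist_le_infDist_add_dist (s := T) (x := s) (y := q k)
      rw [dist_comm] at this
      linarith [hqN k hk]
  have hall : ∀ k ≤ m, dist (q k) (x.seq i) ≤ 2 * ε * c i := by
    intro k
    induction k with
    | zero => intro _; rw [q0, dist_self]; positivity
    | succ k ih =>
      intro hk
      refine (hclose (k + 1) hk).resolve_right fun hcon => ?_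
      have t1 := ih (by omega)
      have t2 := hq.step k (by omega)
      have t3 := dist_triangle4 (x.seq i) (q k) (q (k + 1)) (y.seq i)
      rw [dist_comm (x.seq i) (q k)] at t3
      linarith
  have := hall m le_rfl
  rw [qm, dist_comm] at this
  nlinarith

/-- A simple path that leaves the cone of a Morse subset contains an arc that meets it only in its
two endpoints, which coincide by `IsDiscretelyMorse.eq_of_path`. -/
theorem IsDiscretelyMorse.isStronglyConvex (hE : HasUnitGeodesics E) (hT : IsDiscretelyMorse T)
    (hω : (ω : Filter ℕ) ≤ atTop) (hz : ∀ i, z i ∈ T) :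
    IsStronglyConvex (subspaceCone ω c z T) := by
  rintro x y γ hγ hx hy _ ⟨t₀, rfl⟩
  by_contra ht₀
  have hKc : IsClosed (subspaceCone ω c z T) := isClosed_subspaceCone hω hz
  set f : ℝ → Cone E ω c z := ⇑γ.extend with hf
  have hfc : Continuous f := γ.extend.continuous
  have hft : ∀ t : unitInterval, f t = γ t := fun t => γ.extend_apply t.2
  have hZ : IsClosed (f ⁻¹' subspaceCone ω c z T) := hKc.preimage hfc
  -- The last time before `t₀` and the first time after `t₀` at which the path is in the cone.
  obtain ⟨a, ⟨haK, ha⟩, hamax⟩ := (isCompact_Icc.inter_left hZ).exists_isGreatest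
    (s := f ⁻¹' subspaceCone ω c z T ∩ Set.Icc 0 (t₀ : ℝ))
    ⟨0, by simpa [hf] using hx, le_rfl, t₀.2.1⟩
  obtain ⟨b, ⟨hbK, hb⟩, hbmin⟩ := (isCompact_Icc.inter_left hZ).exists_isLeast
    (s := f ⁻¹' subspaceCone ω c z T ∩ Set.Icc (t₀ : ℝ) 1)
    ⟨1, by simpa [hf] using hy, t₀.2.2, le_rfl⟩
  have hat : a < t₀ := lt_of_le_of_ne ha.2 fun h => ht₀ (by rw [← hft, ← h]; exact haK)
  have hbt : t₀ < b := lt_of_le_of_ne hb.1 fun h => ht₀ (by rw [← hft, h]; exact hbK)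
  have heq := hT.eq_of_path hE hω hz hfc (hat.trans hbt) haK hbK fun t ht htK => by
    rcases le_total t t₀ with h | h
    · exact absurd (hamax ⟨htK, ha.1.trans ht.1.le, h⟩) (not_le.mpr ht.1)
    · exact absurd (hbmin ⟨htK, h, ht.2.le.trans hb.2⟩) (not_le.mpr ht.2)
  have ha1 : a ∈ Set.Icc (0 : ℝ) 1 := ⟨ha.1, ha.2.trans t₀.2.2⟩
  have hb1 : b ∈ Set.Icc (0 : ℝ) 1 := ⟨t₀.2.1.trans hb.1, hb.2⟩
  have := hγ ((hft ⟨a, ha1⟩).symm.trans (heq.trans (hft ⟨b, hb1⟩)))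
  exact (hat.trans hbt).ne (congrArg Subtype.val this)

end Convex

/-! ### Discrete quasi-geodesics near a coarse quasi-geodesic -/

section Coarse

variable {E : Type*} [MetricSpace E]

/-- A coarsely Lipschitz path `v` is followed by walks of linear length inside every set that contains
its neighbourhood: split the time interval into intervals of length at most `1`. -/
theorem joinedWithin_of_coarse_path (hE : HasUnitGeodesics E) {lam C ℓ M : ℝ} (hlam : 1 ≤ lam)
    (hM : lam + C ≤ M) {v : ℝ → E}
    (hup : ∀ s ∈ Set.Icc 0 ℓ, ∀ t ∈ Set.Icc 0 ℓ, dist (v s) (v t) ≤ lam * |s - t| + C)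
    {S : Set E} (hS : ∀ u ∈ Set.Icc 0 ℓ, Metric.closedBall (v u) M ⊆ S) (Λ : ℕ) (k : ℕ) {u u' : ℝ}
    (hu : 0 ≤ u) (huu : u ≤ u') (hu' : u' ≤ ℓ) (hk : u' - u ≤ k) :
    JoinedWithin S Λ (M * k) (v u) (v u') := by
  induction k generalizing u' with
  | zero =>
    obtain rfl : u = u' := le_antisymm huu (by simpa using hk)
    exact ⟨0, by simp, .nil _⟩
  | succ k ih =>
    push_cast at hk
    have h1 : max u (u' - 1) ≤ u' := max_le huu (by linarith)
    have h2 : max u (u' - 1) - u ≤ k := by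
      rw [sub_le_iff_le_add]
      exact max_le (by linarith [Nat.cast_nonneg (α := ℝ) k]) (by linarith)
    have h3 : max u (u' - 1) ∈ Set.Icc 0 ℓ := ⟨hu.trans (le_max_left _ _), h1.trans hu'⟩
    have h4 := hup _ h3 u' ⟨hu.trans huu, hu'⟩
    have h5 : |max u (u' - 1) - u'| ≤ 1 := by
      rw [abs_sub_comm, abs_of_nonneg (by linarith)]
      linarith [le_max_right u (u' - 1)]
    have h6 : dist (v (max u (u' - 1))) (v u') ≤ M := by nlinarith
    refine ((ih (le_max_left _ _) (h1.trans hu') h2).trans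
      (hE.joinedWithin h6 (hS _ h3))).mono ?_
    push_cast
    linarith

/-- Let a coarse quasi-geodesic `v` with endpoints close to `T` have distance `D` from `T` at time
`t`, which is at least half of its greatest distance from `T`. Cut `v` at times of distance
proportional to `D` from `t`, join the ends to `T`, and take a shortest walk for the weight that
favours a neighbourhood `S` of the result. Since `t` separates `S` coarsely, this discrete
quasi-geodesic passes close to `v t`. -/
theorem exists_isDiscreteQuasiGeodesic_of_coarse (hE : HasUnitGeodesics E) (T : Set E)
    {lam C : ℝ} (hlam : 1 ≤ lam) (hC : 0 ≤ C) :
    ∃ (L : ℝ) (Λ : ℕ) (D₀ : ℝ), 0 ≤ L ∧ 1 ≤ Λ ∧ ∀ (ℓ : ℝ) (v : ℝ → E) (t D : ℝ),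
      t ∈ Set.Icc 0 ℓ → D₀ ≤ D →
      (∀ s ∈ Set.Icc 0 ℓ, ∀ t ∈ Set.Icc 0 ℓ, |s - t| ≤ lam * (dist (v s) (v t) + C)) →
      (∀ s ∈ Set.Icc 0 ℓ, ∀ t ∈ Set.Icc 0 ℓ, dist (v s) (v t) ≤ lam * |s - t| + C) →
      (∃ x ∈ T, dist (v 0) x ≤ 1) → (∃ y ∈ T, dist (v ℓ) y ≤ 1) →
      D ≤ Metric.infDist (v t) T → (∀ u ∈ Set.Icc 0 ℓ, Metric.infDist (v u) T ≤ 2 * D) →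
      ∃ (m : ℕ) (q : ℕ → E), (m : ℝ) ≤ L * D ∧ IsDiscreteQuasiGeodesic Λ m q ∧ q 0 ∈ T ∧
        q m ∈ T ∧ ∃ k ≤ m, D / 2 ≤ Metric.infDist (q k) T := by
  set M := lam + C + 1 with hM
  -- The cut is at distance `R * D` from `t`, which outweighs the two geodesics of length `3 * D`
  -- that join the ends to `T`. The walk leaves `S` by at most `η * D`, and `lam ^ 2 * η` is small.
  set R := 10 * lam with hR
  set L := 6 + M * (2 * R + 1) with hL
  set η := 1 / (16 * lam ^ 2) with hη
  have hlam0 : 0 < lam := by linarith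
  have hηpos : 0 < η := by positivity
  have hηlam : lam ^ 2 * η = 1 / 16 := by rw [hη]; field_simp
  have hη16 : η ≤ 1 / 16 := by nlinarith [mul_le_mul_of_nonneg_right (show 1 ≤ lam ^ 2 by nlinarith) hηpos.le]
  obtain ⟨Λ, hΛ⟩ := exists_nat_ge (max 1 (L / η))
  have hΛ1 : 1 ≤ Λ := by exact_mod_cast (le_max_left _ _).trans hΛ
  have hΛη : L ≤ Λ * η := (div_le_iff₀ hηpos).mp ((le_max_right _ _).trans hΛ)
  set B := M + lam * (lam * (2 * M + 1 + C)) + C with hB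
  have hBM : M ≤ B ∧ C ≤ B := by
    have : 0 ≤ lam * (lam * (2 * M + 1 + C)) := by positivity
    constructor <;> linarith
  refine ⟨L, Λ, 4 * B + 10, by positivity, hΛ1, ?_⟩
  intro ℓ v t D ht hD hlow hup hx hy hDt hDu
  have hDpos : 10 ≤ D := by linarith
  have hℓ : 0 ≤ ℓ := ht.1.trans ht.2
  have hTne : T.Nonempty := hx.imp fun _ h => h.1
  set S : Set E := {z | ∃ u ∈ Set.Icc 0 ℓ, dist z (v u) ≤ M ∨
    (R * D ≤ |u - t| ∧ dist z (v u) ≤ 3 * D)} with hS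
  -- The points of `v` at the ends of the cut-out part are joined to `T` inside `S`.
  have hend : ∀ u ∈ Set.Icc 0 ℓ, (u = 0 ∨ u = ℓ ∨ R * D ≤ |u - t|) → ∃ x ∈ T,
      (dist x (v u) ≤ M ∨ (R * D ≤ |u - t| ∧ dist x (v u) ≤ 3 * D)) ∧
        JoinedWithin S Λ (3 * D) (v u) x := by
    intro u hu h
    have short : (∃ x ∈ T, dist (v u) x ≤ 1) → ∃ x ∈ T,
      (dist x (v u) ≤ M ∨ (R * D ≤ |u - t| ∧ dist x (v u) ≤ 3 * D)) ∧
        JoinedWithin S Λ (3 * D) (v u) x := by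
      rintro ⟨x, hxT, hx1⟩
      have hxM : dist (v u) x ≤ M := by linarith
      refine ⟨x, hxT, Or.inl (by rwa [dist_comm]), ?_⟩
      exact (hE.joinedWithin (S := S) hxM fun w hw => ⟨u, hu, Or.inl hw⟩).mono (by linarith)
    rcases h with rfl | rfl | h
    · exact short hx
    · exact short hy
    · obtain ⟨x, hxT, hx3⟩ := (Metric.infDist_lt_iff (r := 3 * D) hTne).mp
        ((hDu u hu).trans_lt (by linarith))
      exact ⟨x, hxT, Or.inr ⟨h, by rw [dist_comm]; exact hx3.le⟩,
        hE.joinedWithin hx3.le fun w hw => ⟨u, hu, Or.inr ⟨h, hw⟩⟩⟩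
  have hRD : 0 ≤ R * D := by positivity
  obtain ⟨s₁, hs₁, hs₁t, hs₁R, hs₁'⟩ : ∃ s ∈ Set.Icc 0 ℓ, s ≤ t ∧ t - s ≤ R * D ∧
      (s = 0 ∨ s = ℓ ∨ R * D ≤ |s - t|) := by
    rcases le_total (t - R * D) 0 with h | h
    · exact ⟨0, ⟨le_rfl, hℓ⟩, ht.1, by linarith, Or.inl rfl⟩
    · refine ⟨t - R * D, ⟨h, by linarith [ht.2]⟩, by linarith, by linarith, Or.inr (Or.inr ?_)⟩
      rw [sub_sub_cancel_left, abs_neg, abs_of_nonneg hRD]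
  obtain ⟨s₂, hs₂, hs₂t, hs₂R, hs₂'⟩ : ∃ s ∈ Set.Icc 0 ℓ, t ≤ s ∧ s - t ≤ R * D ∧
      (s = 0 ∨ s = ℓ ∨ R * D ≤ |s - t|) := by
    rcases le_total (t + R * D) ℓ with h | h
    · refine ⟨t + R * D, ⟨by linarith [ht.1], h⟩, by linarith, by linarith, Or.inr (Or.inr ?_)⟩
      rw [add_sub_cancel_left, abs_of_nonneg hRD]
    · exact ⟨ℓ, ⟨hℓ, le_rfl⟩, ht.2, by linarith, Or.inr (Or.inl rfl)⟩
  obtain ⟨x, hxT, hxS, hxj⟩ := hend s₁ hs₁ hs₁'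
  obtain ⟨y, hyT, hyS, hyj⟩ := hend s₂ hs₂ hs₂'
  have hmid := joinedWithin_of_coarse_path hE hlam (M := M) (by linarith) hup
    (S := S) (fun u hu w hw => ⟨u, hu, Or.inl hw⟩) Λ ⌈s₂ - s₁⌉₊ hs₁.1 (hs₁t.trans hs₂t) hs₂.2
    (Nat.le_ceil _)
  have hcost : 3 * D + M * (⌈s₂ - s₁⌉₊ : ℝ) + 3 * D ≤ L * D := by
    have h1 := (Nat.ceil_lt_add_one (show 0 ≤ s₂ - s₁ by linarith)).le
    have h2 : (⌈s₂ - s₁⌉₊ : ℝ) ≤ (2 * R + 1) * D := by linarith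
    have h3 := mul_le_mul_of_nonneg_left h2 (show 0 ≤ M by positivity)
    linarith
  obtain ⟨m, q, hm, q0, qm, hq, hnear⟩ := ((hxj.symm.trans hmid).trans hyj).mono hcost
    |>.exists_isDiscreteQuasiGeodesic hE hΛ1 (show x ∈ S from ⟨s₁, hs₁, hxS⟩)
  refine ⟨m, q, hm, hq, q0 ▸ hxT, qm ▸ hyT, ?_⟩
  set Near : ℝ → E → Prop := fun u z => u ∈ Set.Icc 0 ℓ ∧ (dist z (v u) ≤ M + η * D ∨
    (R * D ≤ |u - t| ∧ dist z (v u) ≤ 3 * D + η * D)) with hNear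
  have hηD : 0 ≤ η * D := by positivity
  have hηD' : η * D ≤ D / 16 := by nlinarith
  have hqS : ∀ k ≤ m, ∃ u, Near u (q k) := by
    intro k hk
    obtain ⟨s, ⟨u, hu, hs⟩, hle⟩ := hnear k hk
    have hΛpos : (0 : ℝ) < Λ := by exact_mod_cast hΛ1
    have hds : dist (q k) s ≤ η * D := by
      refine le_of_mul_le_mul_left (hle.trans ?_) hΛpos
      rw [← mul_assoc]
      exact mul_le_mul_of_nonneg_right hΛη (by linarith)
    have htri := dist_triangle (q k) s (v u)
    exact ⟨u, hu, hs.imp (fun h => by linarith) fun h => ⟨h.1, by linarith [h.2]⟩⟩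
  -- The walk crosses from the part of `S` before time `t` to the part after it.
  obtain ⟨i, hi, j, hj, hij, ⟨u, hut, hu⟩, ⟨u', htu', hu'⟩⟩ : ∃ i ≤ m, ∃ j ≤ m,
      dist (q i) (q j) ≤ 1 ∧ (∃ u ≤ t, Near u (q i)) ∧ (∃ u ≥ t, Near u (q j)) := by
    by_contra! hcon
    have hleft : ∃ u ≤ t, Near u (q 0) :=
      ⟨s₁, hs₁t, hs₁, q0 ▸ hxS.imp (fun h => by linarith) fun h => ⟨h.1, by linarith [h.2]⟩⟩
    have hnot : ∀ k ≤ m, ∀ u ≥ t, ¬ Near u (q k) := by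
      intro k
      induction k with
      | zero => exact fun h0 => hcon 0 h0 0 h0 (by simp) hleft
      | succ k ih =>
        intro hk
        obtain ⟨u, hu⟩ := hqS k (by omega)
        have hut : u ≤ t := by
          by_contra! h
          exact ih (by omega) u h.le hu
        exact hcon k (by omega) (k + 1) hk (hq.step k (by omega)) ⟨u, hut, hu⟩
    exact hnot m le_rfl s₂ hs₂t
      ⟨hs₂, qm ▸ hyS.imp (fun h => by linarith) fun h => ⟨h.1, by linarith [h.2]⟩⟩
  refine ⟨i, hi, ?_⟩
  obtain ⟨huℓ, hu⟩ := hu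
  obtain ⟨huℓ', hu'⟩ := hu'
  have habs : |u - u'| = (u' - t) + (t - u) := by rw [abs_sub_comm, abs_of_nonneg] <;> linarith
  have habs1 : |u - t| = t - u := by rw [abs_sub_comm, abs_of_nonneg]; linarith
  have habs2 : |u' - t| = u' - t := by rw [abs_of_nonneg]; linarith
  have hl := hlow u huℓ u' huℓ'
  have htri := dist_triangle4 (v u) (q i) (q j) (v u')
  rw [dist_comm (v u) (q i)] at htri
  have hlong : R * D ≤ |u - u'| → dist (q i) (v u) ≤ 4 * D → dist (q j) (v u') ≤ 4 * D →
      False := by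
    intro h1 h2 h3
    have h4 : dist (v u) (v u') + C < 10 * D := by linarith
    have h5 := mul_lt_mul_of_pos_left h4 hlam0
    rw [hR] at h1
    linarith
  rcases hu with hu | ⟨hu, hud⟩
  · rcases hu' with hu' | ⟨hu', hud'⟩
    · have h1 : t - u ≤ lam * (2 * M + 1 + C + 2 * (η * D)) := by
        refine le_trans (by linarith) (hl.trans (mul_le_mul_of_nonneg_left ?_ hlam0.le))
        linarith
      have h2 := hup u huℓ t ht
      rw [habs1] at h2
      have h3 := mul_le_mul_of_nonneg_left h1 hlam0.le
      have h4 : lam * (lam * (2 * M + 1 + C + 2 * (η * D))) =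
          lam * (lam * (2 * M + 1 + C)) + D / 8 := by
        have : lam * (lam * (2 * (η * D))) = 2 * (lam ^ 2 * η) * D := by ring
        rw [mul_add, mul_add, this, hηlam]
        ring
      have h5 : dist (q i) (v t) ≤ D / 2 := by
        linarith [dist_triangle (q i) (v u) (v t)]
      have h6 := Metric.infDist_le_infDist_add_dist (s := T) (x := v t) (y := q i)
      rw [dist_comm] at h6
      linarith
    · exact (hlong (by linarith) (by linarith) (by linarith)).elim
  · exact (hlong (by linarith) (by linarith [hu']) (by rcases hu' with h | h <;> linarith)).elim

variable {G : Type*} [Group G] {X : FiniteGeneratingSet G}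

/-- The quasi-geodesics that violate the Morse property are replaced by discrete ones whose length is
bounded linearly by a distance from `H` which they reach. -/
theorem exists_isDiscreteQuasiGeodesic_of_not_isStronglyQuasiConvex {H : Subgroup G}
    (h : ¬ IsStronglyQuasiConvex X H) :
    ∃ (L : ℝ) (Λ : ℕ), 0 ≤ L ∧ 1 ≤ Λ ∧ ∀ n : ℝ, ∃ D ≥ n, ∃ (m : ℕ) (q : ℕ → WordSpace X),
      (m : ℝ) ≤ L * D ∧ IsDiscreteQuasiGeodesic Λ m q ∧ (q 0).val ∈ H ∧ (q m).val ∈ H ∧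
        ∃ k ≤ m, D / 2 ≤ Metric.infDist (q k) {g : WordSpace X | g.val ∈ H} := by
  set T := {g : WordSpace X | g.val ∈ H} with hT
  unfold IsStronglyQuasiConvex IsMorse at h
  push Not at h
  obtain ⟨lam, C, hlam, hC, hbad⟩ := h
  have hlam0 : 0 < lam := by linarith
  obtain ⟨L, Λ, D₀, hL, hΛ, key⟩ := exists_isDiscreteQuasiGeodesic_of_coarse
    WordSpace.hasUnitGeodesics T hlam (show 0 ≤ C + 2 by linarith)
  refine ⟨L, Λ, hL, hΛ, fun n => ?_⟩
  obtain ⟨ℓ, p, hp, hp0, hpℓ, t, ht, hfar⟩ := hbad (2 * max (max n D₀) 1 + 1)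
  choose v hv using fun s => CayleyGraph.exists_vertex_dist_le (p s)
  have hTne : T.Nonempty := ⟨⟨1⟩, H.one_mem⟩
  have hle : ∀ s t, dist (v s) (v t) ≤ dist (p s) (p t) + 2 := fun s t => by
    rw [← CayleyGraph.dist_vertex]
    have := dist_triangle4 (CayleyGraph.vertex X (v s).val) (p s) (p t)
      (CayleyGraph.vertex X (v t).val)
    rw [dist_comm _ (p s)] at this
    linarith [hv s, hv t]
  have hge : ∀ s t, dist (p s) (p t) ≤ dist (v s) (v t) + 2 := fun s t => by
    rw [← CayleyGraph.dist_vertex]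
    have := dist_triangle4 (p s) (CayleyGraph.vertex X (v s).val) (CayleyGraph.vertex X (v t).val)
      (p t)
    rw [dist_comm (CayleyGraph.vertex X (v t).val) (p t)] at this
    linarith [hv s, hv t]
  have hup : ∀ s ∈ Set.Icc 0 ℓ, ∀ t ∈ Set.Icc 0 ℓ,
      dist (v s) (v t) ≤ lam * |s - t| + (C + 2) := fun s hs t ht => by
    have := hp.upper s hs t ht
    rw [Real.dist_eq] at this
    linarith [hle s t]
  have hlow : ∀ s ∈ Set.Icc 0 ℓ, ∀ t ∈ Set.Icc 0 ℓ,
      |s - t| ≤ lam * (dist (v s) (v t) + (C + 2)) := fun s hs t ht => by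
    have := hp.lower s hs t ht
    rw [Real.dist_eq, sub_le_iff_le_add, div_le_iff₀' hlam0] at this
    exact this.trans (mul_le_mul_of_nonneg_left (by linarith [hge s t]) hlam0.le)
  have hend : ∀ s, p s ∈ CayleyGraph.vertex X '' (H : Set G) → ∃ x ∈ T, dist (v s) x ≤ 1 := by
    rintro s ⟨g, hg, hgs⟩
    refine ⟨⟨g⟩, hg, ?_⟩
    rw [← CayleyGraph.dist_vertex, dist_comm, hgs]
    exact hv s
  have ht1 : 2 * max (max n D₀) 1 ≤ Metric.infDist (v t) T := by
    rw [Metric.le_infDist hTne]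
    intro g hg
    by_contra! hlt
    refine hfar (Metric.mem_thickening_iff.mpr ⟨_, ⟨g.val, hg, rfl⟩, ?_⟩)
    have := dist_triangle (p t) (CayleyGraph.vertex X (v t).val) (CayleyGraph.vertex X g.val)
    rw [CayleyGraph.dist_vertex] at this
    linarith [hv t]
  -- A time at which the distance from `H` is at least half of its supremum.
  have h0mem : (0 : ℝ) ∈ Set.Icc 0 ℓ := ⟨le_rfl, hp.length_nonneg⟩
  set A := (fun s => Metric.infDist (v s) T) '' Set.Icc 0 ℓ with hA
  have hAbdd : BddAbove A := by
    refine ⟨Metric.infDist (v 0) T + (lam * ℓ + (C + 2)), ?_⟩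
    rintro _ ⟨s, hs, rfl⟩
    have h1 := Metric.infDist_le_infDist_add_dist (s := T) (x := v s) (y := v 0)
    have h2 := hup s hs 0 h0mem
    rw [sub_zero, abs_of_nonneg hs.1] at h2
    have h3 := mul_le_mul_of_nonneg_left hs.2 hlam0.le
    linarith
  have hmax := le_max_right (max n D₀) 1
  have hAt : Metric.infDist (v t) T ≤ sSup A := le_csSup hAbdd ⟨t, ht, rfl⟩
  obtain ⟨_, ⟨t', ht', rfl⟩, hlt⟩ := exists_lt_of_lt_csSup (s := A) ⟨_, t, ht, rfl⟩
    (show sSup A / 2 < sSup A by linarith)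
  have hmax' := le_max_left (max n D₀) 1
  have hn := le_max_left n D₀
  have hD₀ := le_max_right n D₀
  simp only at hlt
  obtain ⟨m, q, hq⟩ := key ℓ v t' (Metric.infDist (v t') T) ht' (by linarith) hlow hup
    (hend 0 hp0) (hend ℓ hpℓ) le_rfl fun u hu => by
      have := le_csSup hAbdd ⟨u, hu, rfl⟩
      simp only at this
      linarith
  exact ⟨_, by linarith, m, q, hq⟩

end Coarse

/-! ### Limits of discrete quasi-geodesics -/

section Limit

theorem abs_natFloor_sub_natFloor_sub_le {a b : ℝ} (ha : 0 ≤ a) (hb : 0 ≤ b) :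
    |((⌊a⌋₊ : ℝ) - ⌊b⌋₊) - (a - b)| ≤ 1 := by
  have h1 := Nat.floor_le ha
  have h2 := Nat.lt_floor_add_one a
  have h3 := Nat.floor_le hb
  have h4 := Nat.lt_floor_add_one b
  rw [abs_le]
  constructor <;> linarith

theorem IsDiscreteQuasiGeodesic.dist_le {E : Type*} [PseudoMetricSpace E] {Λ m : ℕ} {q : ℕ → E}
    (h : IsDiscreteQuasiGeodesic Λ m q) {i j : ℕ} (hi : i ≤ m) (hj : j ≤ m) :
    dist (q i) (q j) ≤ |(i : ℝ) - j| := by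
  have key : ∀ i j, i ≤ j → j ≤ m → dist (q i) (q j) ≤ |(i : ℝ) - j| := by
    intro i j hij hj
    rw [abs_sub_comm, abs_of_nonneg (by simpa using hij)]
    refine (dist_le_Ico_sum_dist q hij).trans
      ((Finset.sum_le_card_nsmul _ _ 1 fun k hk => h.step k ?_).trans ?_)
    · exact (Finset.mem_Ico.mp hk).2.trans_le hj
    · simp [Nat.cast_sub hij]
  rcases le_total i j with hij | hij
  · exact key i j hij hj
  · rw [dist_comm, abs_sub_comm]
    exact key j i hij hi

/-- The rescaled limit of discrete quasi-geodesics of linearly growing length is a bi-Lipschitz,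
hence simple, path in the cone. If they start and end in `T`, and reach points whose distance from
`T` grows linearly, then the limit starts and ends in the cone of `T` and leaves it. -/
theorem not_isStronglyConvex_subspaceCone {E : Type*} [PseudoMetricSpace E] {T : Set E}
    {ω : Ultrafilter ℕ} (hω : (ω : Filter ℕ) ≤ atTop) {c : ScalingSequence} {z : ℕ → E} {Λ : ℕ}
    (hΛ : 1 ≤ Λ) {L κ : ℝ} (hκ : 0 < κ) {m : ℕ → ℕ} {q : ℕ → ℕ → E} (q0 : ∀ i, q i 0 = z i)
    (hz : ∀ i, z i ∈ T) (qm : ∀ i, q i (m i) ∈ T) (hm : ∀ i, (m i : ℝ) ≤ L * c i)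
    (hq : ∀ i, IsDiscreteQuasiGeodesic Λ (m i) (q i))
    (hfar : ∀ᶠ i in (ω : Filter ℕ), ∃ k ≤ m i, κ * c i ≤ Metric.infDist (q i k) T) :
    ¬ IsStronglyConvex (subspaceCone ω c z T) := by
  intro hconv
  have hL : 0 ≤ L := nonneg_of_mul_nonneg_left ((Nat.cast_nonneg _).trans (hm 0)) (c.pos 0)
  have hΛ0 : (0 : ℝ) < Λ := by exact_mod_cast hΛ
  set idx : unitInterval → ℕ → ℕ := fun s i => ⌊(s : ℝ) * m i⌋₊ with hidx
  have hsm : ∀ (s : unitInterval) i, 0 ≤ (s : ℝ) * m i := fun s i =>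
    mul_nonneg s.2.1 (Nat.cast_nonneg _)
  have hidx_le : ∀ s i, idx s i ≤ m i := fun s i =>
    Nat.floor_le_of_le (mul_le_of_le_one_left (Nat.cast_nonneg _) s.2.2)
  have hidx_sub : ∀ (s s' : unitInterval) i,
      |((idx s i : ℝ) - idx s' i) - ((s : ℝ) - s') * m i| ≤ 1 := fun s s' i => by
    rw [sub_mul]
    exact abs_natFloor_sub_natFloor_sub_le (hsm s i) (hsm s' i)
  have hmfar : ∀ᶠ i in (ω : Filter ℕ), κ * c i ≤ m i := by
    filter_upwards [hfar] with i ⟨k, hk, hle⟩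
    have h1 := (hq i).dist_le hk (Nat.zero_le _)
    rw [Nat.cast_zero, sub_zero, Nat.abs_cast, q0] at h1
    have h2 := Metric.infDist_le_dist_of_mem (x := q i k) (hz i)
    have h3 : (k : ℝ) ≤ m i := by exact_mod_cast hk
    linarith
  let x : unitInterval → ConeSequence E ω c z := fun s =>
    ⟨fun i => q i (idx s i), L, fun i => by
      have h1 := (hq i).dist_le (Nat.zero_le _) (hidx_le s i)
      have h2 : (idx s i : ℝ) ≤ m i := by exact_mod_cast hidx_le s i
      rw [Nat.cast_zero, zero_sub, abs_neg, Nat.abs_cast, q0] at h1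
      rw [div_le_iff₀ (c.pos i)]
      exact h1.trans (h2.trans (hm i))⟩
  have hlip : ∀ s s', dist (SeparationQuotient.mk (x s) : Cone E ω c z)
      (SeparationQuotient.mk (x s')) ≤ L * dist s s' := by
    intro s s'
    refine le_of_forall_pos_le_add fun ε hε => ?_
    refine le_of_tendsto ((x s).tendsto_dist (x s')) ?_
    filter_upwards [c.eventually_lt_mul hω hε 1] with i hi
    rw [div_le_iff₀ (c.pos i)]
    have h1 := (hq i).dist_le (hidx_le s i) (hidx_le s' i)
    have h2 := abs_sub_abs_le_abs_sub ((idx s i : ℝ) - idx s' i) (((s : ℝ) - s') * m i)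
    have h3 := hidx_sub s s' i
    rw [abs_mul, Nat.abs_cast] at h2
    have h4 := mul_le_mul_of_nonneg_left (hm i) (abs_nonneg ((s : ℝ) - s'))
    rw [Subtype.dist_eq, Real.dist_eq]
    change dist (q i (idx s i)) (q i (idx s' i)) ≤ _
    linarith
  have hinj : Function.Injective fun s => (SeparationQuotient.mk (x s) : Cone E ω c z) := by
    intro s s' heq
    by_contra hne
    have hpos : 0 < |(s : ℝ) - s'| := abs_pos.mpr (sub_ne_zero.mpr fun h => hne (Subtype.ext h))
    have hd : dist (SeparationQuotient.mk (x s) : Cone E ω c z) (SeparationQuotient.mk (x s')) <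
        |(s : ℝ) - s'| * κ / (2 * Λ) := by
      rw [show (SeparationQuotient.mk (x s) : Cone E ω c z) = SeparationQuotient.mk (x s') from heq,
        dist_self]
      positivity
    obtain ⟨i, h1, h2, h3⟩ := ((ConeSequence.eventually_dist_lt hd).and (hmfar.and
      (c.eventually_lt_mul hω (r := |(s : ℝ) - s'| * κ / 2) (by positivity) 1))).exists
    have h4 := (hq i).lower _ (hidx_le s i) _ (hidx_le s' i)
    have h5 := abs_sub_abs_le_abs_sub (((s : ℝ) - s') * m i) ((idx s i : ℝ) - idx s' i)
    rw [abs_sub_comm _ ((idx s i : ℝ) - idx s' i), abs_mul, Nat.abs_cast] at h5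
    have h6 := hidx_sub s s' i
    have h7 := mul_le_mul_of_nonneg_left h2 hpos.le
    have h8 := mul_lt_mul_of_pos_left h1 hΛ0
    change Λ * dist (q i (idx s i)) (q i (idx s' i)) < _ at h8
    have h9 : (Λ : ℝ) * (|(s : ℝ) - s'| * κ / (2 * Λ) * c i) = |(s : ℝ) - s'| * κ / 2 * c i := by
      field_simp
    rw [h9] at h8
    linarith
  let γ : Path (SeparationQuotient.mk (x 0) : Cone E ω c z) (SeparationQuotient.mk (x 1)) :=
    { toFun := fun s => SeparationQuotient.mk (x s)
      continuous_toFun := (LipschitzWith.of_dist_le_mul (K := ⟨L, hL⟩) hlip).continuous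
      source' := rfl
      target' := rfl }
  have hrange := hconv _ _ γ hinj ⟨x 0, fun i => by simpa [x, idx, q0] using hz i, rfl⟩
    ⟨x 1, fun i => by simpa [x, idx] using qm i, rfl⟩
  -- A limit, along `ω`, of the times at which the distance from `T` is large.
  obtain ⟨k, hkm, hkfar⟩ : ∃ k : ℕ → ℕ, (∀ i, k i ≤ m i) ∧
      ∀ᶠ i in (ω : Filter ℕ), κ * c i ≤ Metric.infDist (q i (k i)) T := by
    have : ∀ i, ∃ k ≤ m i, (∃ k ≤ m i, κ * c i ≤ Metric.infDist (q i k) T) →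
        κ * c i ≤ Metric.infDist (q i k) T := fun i => by
      by_cases h : ∃ k ≤ m i, κ * c i ≤ Metric.infDist (q i k) T
      · obtain ⟨k, hk, hle⟩ := h
        exact ⟨k, hk, fun _ => hle⟩
      · exact ⟨0, Nat.zero_le _, fun h' => absurd h' h⟩
    choose k hkm hk using this
    exact ⟨k, hkm, hfar.mono fun i hi => hk i hi⟩
  let τ : ℕ → unitInterval := fun i => ⟨(k i : ℝ) / m i, by positivity,
    div_le_one_of_le₀ (by exact_mod_cast hkm i) (Nat.cast_nonneg _)⟩
  obtain ⟨s, -, hs⟩ := isCompact_univ.ultrafilter_le_nhds (ω.map τ) (by simp)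
  have hτ : ∀ᶠ i in (ω : Filter ℕ), dist (τ i) s < κ / (4 * (L + 1)) :=
    hs (Metric.ball_mem_nhds s (by positivity))
  obtain ⟨t, htT, ht⟩ := hrange ⟨s, rfl⟩
  have hd : dist (SeparationQuotient.mk t : Cone E ω c z) (SeparationQuotient.mk (x s)) < κ / 4 := by
    rw [show SeparationQuotient.mk t = SeparationQuotient.mk (x s) from ht, dist_self]
    positivity
  obtain ⟨i, h1, h2, h3, h4, h5⟩ := ((ConeSequence.eventually_dist_lt hd).and (hmfar.and
    (hτ.and (hkfar.and (c.eventually_lt_mul hω (r := κ / 4) (by positivity) 1))))).exists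
  have hci := c.pos i
  have hmi : (0 : ℝ) < m i := lt_of_lt_of_le (by positivity) h2
  have h6 := (hq i).dist_le (hkm i) (hidx_le s i)
  have h7 : |(k i : ℝ) - idx s i| ≤ κ / 4 * c i + 1 := by
    have e1 : |(k i : ℝ) - s * m i| ≤ κ / 4 * c i := by
      have e2 : (k i : ℝ) - s * m i = ((τ i : ℝ) - s) * m i := by
        change _ = ((k i : ℝ) / m i - s) * m i
        field_simp
      rw [Subtype.dist_eq, Real.dist_eq] at h3
      rw [e2, abs_mul, Nat.abs_cast]
      calc |(τ i : ℝ) - s| * m i ≤ κ / (4 * (L + 1)) * ((L + 1) * c i) := by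
            gcongr
            linarith [hm i]
        _ = κ / 4 * c i := by field_simp
    have e3 := abs_sub_le (k i : ℝ) (s * m i) (idx s i)
    have e4 : |(s : ℝ) * m i - idx s i| ≤ 1 := by
      rw [abs_of_nonneg (sub_nonneg.mpr (Nat.floor_le (hsm s i)))]
      linarith [Nat.lt_floor_add_one ((s : ℝ) * m i)]
    linarith
  change dist (t.seq i) (q i (idx s i)) < _ at h1
  have h8 := Metric.infDist_le_dist_of_mem (x := q i (k i)) (htT i)
  have h9 := dist_triangle_right (q i (k i)) (t.seq i) (q i (idx s i))
  linarith

end Limit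

/-! ### The group case -/

section Group

variable {G : Type*} [Group G] {X : FiniteGeneratingSet G}

theorem infDist_le_infDist_mul_left (H : Subgroup G) {h : G} (hh : h ∈ H) (u : WordSpace X) :
    Metric.infDist u {g : WordSpace X | g.val ∈ H} ≤
      Metric.infDist (⟨h * u.val⟩ : WordSpace X) {g : WordSpace X | g.val ∈ H} := by
  rw [Metric.le_infDist ⟨⟨1⟩, H.one_mem⟩]
  intro y hy
  have hmem : (⟨h⁻¹ * y.val⟩ : WordSpace X) ∈ {g : WordSpace X | g.val ∈ H} :=
    H.mul_mem (H.inv_mem hh) hy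
  refine (Metric.infDist_le_dist_of_mem hmem).trans_eq ?_
  rw [← WordSpace.dist_mul_left h]
  simp

/-- If `H` is not strongly quasi-convex, then the cone of `H` fails to be strongly convex for some
non-principal ultrafilter, which is concentrated on the scales of a sequence of quasi-geodesics
that leave larger and larger neighbourhoods of `H`. -/
theorem exists_not_isStronglyConvex {H : Subgroup G} (h : ¬ IsStronglyQuasiConvex X H) :
    ∃ ω : Ultrafilter ℕ, (∀ n, ω ≠ pure n) ∧ ¬ IsStronglyConvex (subgroupCone X ω H) := by
  set T := {g : WordSpace X | g.val ∈ H} with hT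
  obtain ⟨L, Λ, hL, hΛ, hex⟩ := exists_isDiscreteQuasiGeodesic_of_not_isStronglyQuasiConvex h
  let Good : ℕ → ℕ → (ℕ → WordSpace X) → Prop := fun i m q =>
    q 0 = ⟨1⟩ ∧ q m ∈ T ∧ (m : ℝ) ≤ L * linearScaling i ∧ IsDiscreteQuasiGeodesic Λ m q
  let Far : ℕ → ℕ → (ℕ → WordSpace X) → Prop := fun i m q =>
    ∃ k ≤ m, 1 / 4 * linearScaling i ≤ Metric.infDist (q k) T
  have hfreq : ∃ᶠ i in atTop, ∃ m q, Good i m q ∧ Far i m q := by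
    rw [frequently_atTop]
    intro n
    obtain ⟨D, hD, m, q, hm, hq, q0, qm, k, hk, hfar⟩ := hex (max n 1)
    have hD1 : 1 ≤ D := (le_max_right _ _).trans hD
    have hfl := Nat.floor_le (zero_le_one.trans hD1)
    have hfl' := Nat.lt_floor_add_one D
    have hscale : linearScaling ⌊D⌋₊ = (⌊D⌋₊ : ℝ) + 1 := rfl
    refine ⟨⌊D⌋₊, Nat.le_floor ((le_max_left _ _).trans hD), m,
      fun k => ⟨(q 0).val⁻¹ * (q k).val⟩, ⟨by simp, H.mul_mem (H.inv_mem q0) qm, ?_, ?_, ?_⟩,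
      k, hk, ?_⟩
    · exact hm.trans (mul_le_mul_of_nonneg_left (by linarith) hL)
    · intro k hk
      rw [WordSpace.dist_mul_left]
      exact hq.step k hk
    · intro i hi j hj
      rw [WordSpace.dist_mul_left]
      exact hq.lower i hi j hj
    · refine le_trans ?_ (hfar.trans (infDist_le_infDist_mul_left H (H.inv_mem q0) (q k)))
      linarith
  have := frequently_iff_neBot.mp hfreq
  obtain ⟨ω, hωle⟩ := Ultrafilter.exists_le (atTop ⊓ 𝓟 {i : ℕ | ∃ m q, Good i m q ∧ Far i m q})
  have hω : (ω : Filter ℕ) ≤ atTop := hωle.trans inf_le_left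
  have hgood : ∀ᶠ i in (ω : Filter ℕ), ∃ m q, Good i m q ∧ Far i m q :=
    le_principal_iff.mp (hωle.trans inf_le_right)
  have hall : ∀ i, ∃ m q, Good i m q ∧ ((∃ m q, Good i m q ∧ Far i m q) → Far i m q) := by
    intro i
    by_cases hi : ∃ m q, Good i m q ∧ Far i m q
    · obtain ⟨m, q, h1, h2⟩ := hi
      exact ⟨m, q, h1, fun _ => h2⟩
    · refine ⟨0, fun _ => ⟨1⟩, ⟨rfl, H.one_mem, ?_, ⟨by simp, ?_⟩⟩, fun h' => absurd h' hi⟩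
      · rw [Nat.cast_zero]
        exact mul_nonneg hL (linearScaling.pos i).le
      · intro i hi j hj
        simp [Nat.le_zero.mp hi, Nat.le_zero.mp hj]
  choose m q hGood hFar using hall
  refine ⟨ω, fun n hn => ?_, not_isStronglyConvex_subspaceCone hω hΛ (L := L) (κ := 1 / 4)
    (by norm_num) (m := m) (q := q) (fun i => (hGood i).1) (fun _ => H.one_mem)
    (fun i => (hGood i).2.1) (fun i => (hGood i).2.2.1) (fun i => (hGood i).2.2.2)
    (hgood.mono fun i hi => hFar i hi)⟩
  have := hω (Ici_mem_atTop (n + 1))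
  rw [hn] at this
  simp at this

end Group

theorem theorem1p10 {G : Type*} [Group G] (X : FiniteGeneratingSet G)
    (H : Subgroup G) (hH : H.FG) :
    IsStronglyQuasiConvex X H ↔
      ∀ ω : Ultrafilter ℕ, (∀ n : ℕ, ω ≠ pure n) →
        IsStronglyConvex (subgroupCone X ω H) := by
  refine ⟨fun h ω hω => ?_, fun h => ?_⟩
  · exact h.isDiscretelyMorse.isStronglyConvex WordSpace.hasUnitGeodesics
      (Ultrafilter.le_atTop_of_forall_ne_pure hω) fun _ => H.one_mem
  · by_contra hcon
    obtain ⟨ω, hω, hnot⟩ := exists_not_isStronglyConvex hcon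
    exact hnot (h ω hω)
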